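/- A hyperbolic $n$-manifold is a connected, complete Riemannian $n$-manifold (without boundary) of constant sectional curvature $-1$. A hyperbolic gravitational instanton with initial hypersurface $\Sigma$ is an orientable hyperbolic 4-manifold $M$ of finite volume together with a totally geodesic, orientable hypersurface $\Sigma\subset M$ that separates $M$ (that is, $M\setminus\Sigma$ is disconnected) and that is the set of fixed points of an orientation reversing isometric involution of $M$. Let $N$ be a nonorientable hyperbolic 4-manifold of finite volume. Let $S$ be a cross-section of $N$, that is, a hypersurface of $N$ which is a connected component of the set of fixed points of an isometric involution $\rho$ of $N$ (for instance the whole fixed point set, if that is a connected hypersurface). Assume that $S$ does not separate $N$, i.e. that $N\setminus S$ is connected. Let $p\colon M\to N$ be the orientable double cover of $N$, with the hyperbolic metric for which $p$ is a local isometry, and let $\Sigma=p^{-1}(S)$ be the hypersurface of $M$ covering $S$. Then $M$ is a hyperbolic gravitational instanton with initial hypersurface $\Sigma$ and $\Sigma$ is connected if and only if $S$ is orientable, $S$ is one-sided in $N$, and $N\setminus S$ is orientable. -/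

import Mathlib

/-!  Hyperbolic manifolds, their orientations and hypersurfaces, and hyperbolic gravitational
instantons. -/

/-- The distance of hyperbolic `n`-space in the conformal ball model, a function of two points of
the open unit ball of Euclidean `n`-space. -/
noncomputable def hypDist {n : ℕ} (x y : EuclideanSpace ℝ (Fin n)) : ℝ :=
  Real.arcosh (1 + 2 * ‖x - y‖ ^ 2 / ((1 - ‖x‖ ^ 2) * (1 - ‖y‖ ^ 2)))

/-- A hyperbolic chart: an isometry of an open subset of the metric space `X` (with the restricted
distance) onto an open subset of hyperbolic `n`-space (conformal ball model). -/
structure IsHyperbolicChart (n : ℕ) {X : Type*} [MetricSpace X]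
    (e : OpenPartialHomeomorph X (EuclideanSpace ℝ (Fin n))) : Prop where
  target_subset : e.target ⊆ Metric.ball 0 1
  dist_eq : ∀ x ∈ e.source, ∀ y ∈ e.source, dist x y = hypDist (e x) (e y)

/-- A hyperbolic `n`-manifold: a connected and complete Riemannian manifold of constant sectional
curvature `-1`, given through its Riemannian distance. That is, a connected complete metric space
whose distance is the infimum of the lengths of paths and which is locally isometric to
hyperbolic `n`-space. -/
structure IsHyperbolicManifold (n : ℕ) (X : Type*) [MetricSpace X] : Prop where
  connected : ConnectedSpace X
  complete : CompleteSpace X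
  length_metric : ∀ x y : X, ∀ ε > 0, ∃ γ : Path x y,
    eVariationOn γ Set.univ ≤ ENNReal.ofReal (dist x y + ε)
  locally_hyperbolic : ∀ x : X, ∃ e : OpenPartialHomeomorph X (EuclideanSpace ℝ (Fin n)),
    IsHyperbolicChart n e ∧ x ∈ e.source

/-- Finite `n`-dimensional volume. The `n`-dimensional Hausdorff measure of a Riemannian
`n`-manifold is a positive constant multiple of the Riemannian volume. -/
def HasFiniteVolume (n : ℕ) (X : Type*) [MetricSpace X] : Prop :=
  letI : MeasurableSpace X := borel X
  haveI : BorelSpace X := ⟨rfl⟩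
  MeasureTheory.Measure.hausdorffMeasure (n : ℝ) (Set.univ : Set X) < ⊤

/-- An oriented atlas: hyperbolic charts that cover `X` and whose coordinate changes have positive
Jacobian determinant. (A derivative that does not exist has determinant `0` for `n > 0`.) -/
structure IsOrientedAtlas (n : ℕ) {X : Type*} [MetricSpace X]
    (A : Set (OpenPartialHomeomorph X (EuclideanSpace ℝ (Fin n)))) : Prop where
  isHyperbolicChart : ∀ e ∈ A, IsHyperbolicChart n e
  cover : ∀ x : X, ∃ e ∈ A, x ∈ e.source
  det_pos : ∀ e ∈ A, ∀ e' ∈ A, ∀ x ∈ e.source, x ∈ e'.source →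
    0 < (fderiv ℝ (fun v => e' (e.symm v)) (e x)).det

/-- Orientability. It is used for hyperbolic manifolds, for their open subsets, and for totally
geodesic hypersurfaces; all of these, with the restricted distance, are locally isometric to
hyperbolic space of their dimension. -/
def IsOrientable (n : ℕ) (X : Type*) [MetricSpace X] : Prop :=
  ∃ A : Set (OpenPartialHomeomorph X (EuclideanSpace ℝ (Fin n))), IsOrientedAtlas n A

/-- The isometry `θ` reverses an orientation of `X`. (For a connected `X` it then reverses every
orientation of `X`.) -/
def IsOrientationReversing (n : ℕ) {X : Type*} [MetricSpace X] (θ : X ≃ᵢ X) : Prop :=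
  ∃ A : Set (OpenPartialHomeomorph X (EuclideanSpace ℝ (Fin n))), IsOrientedAtlas n A ∧
    ∀ e ∈ A, ∀ e' ∈ A, ∀ x ∈ e.source, θ x ∈ e'.source →
      (fderiv ℝ (fun v => e' (θ (e.symm v))) (e x)).det < 0

/-- `S` is a totally geodesic hypersurface of the hyperbolic `(n + 1)`-manifold `X`: around each of
its points it corresponds, in a hyperbolic chart, to the hyperbolic hyperplane on which the last
coordinate of the ball model vanishes. -/
def IsTotallyGeodesicHypersurface (n : ℕ) {X : Type*} [MetricSpace X] (S : Set X) : Prop :=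
  ∀ x ∈ S, ∃ e : OpenPartialHomeomorph X (EuclideanSpace ℝ (Fin (n + 1))),
    IsHyperbolicChart (n + 1) e ∧ x ∈ e.source ∧ ∀ y ∈ e.source, y ∈ S ↔ e y (Fin.last n) = 0

/-- The hypersurface `S` is two-sided: it has an open neighbourhood that `S` divides into two
disjoint open sides, both of which are adherent to every point of `S`. -/
def IsTwoSided {X : Type*} [TopologicalSpace X] (S : Set X) : Prop :=
  ∃ U V : Set X, IsOpen U ∧ IsOpen V ∧ Disjoint U V ∧ Disjoint U S ∧ Disjoint V S ∧
    IsOpen (U ∪ S ∪ V) ∧ S ⊆ closure U ∧ S ⊆ closure V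

/-- The hypersurface `S` is one-sided. -/
def IsOneSided {X : Type*} [TopologicalSpace X] (S : Set X) : Prop := ¬ IsTwoSided S

/-- `S` is a cross-section of the 4-manifold `X` along which the isometry `ρ` is a reflective
symmetry: `ρ` is an involution, and `S` is a hypersurface that is a connected component of the set
of fixed points of `ρ` (for instance the whole set, if that is a connected hypersurface). -/
structure IsCrossSection {X : Type*} [MetricSpace X] (ρ : X ≃ᵢ X) (S : Set X) : Prop where
  involutive : Function.Involutive ρ
  component : ∃ x ∈ Function.fixedPoints ρ,
    S = connectedComponentIn (Function.fixedPoints ρ) x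
  hypersurface : IsTotallyGeodesicHypersurface 3 S

/-- `p : M → N` is the orientable double cover of the hyperbolic 4-manifold `N`: `M` is a
(connected, complete) orientable hyperbolic 4-manifold, and `p` is a two-sheeted covering
projection and a local isometry. -/
structure IsOrientableDoubleCover {M N : Type*} [MetricSpace M] [MetricSpace N]
    (p : M → N) : Prop where
  hyperbolic : IsHyperbolicManifold 4 M
  orientable : IsOrientable 4 M
  covering : IsCoveringMap p
  two_sheeted : ∀ x : N, (p ⁻¹' {x}).ncard = 2
  local_isometry : ∀ x : M, ∃ r > 0, ∀ y ∈ Metric.ball x r, ∀ z ∈ Metric.ball x r,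
    dist (p y) (p z) = dist y z

/-- `M` is a hyperbolic gravitational instanton with initial hypersurface `H`: a complete orientable
hyperbolic 4-manifold of finite volume, with a separating, totally geodesic, orientable
hypersurface `H` that is the set of fixed points of an orientation reversing isometric involution.
(Having constant curvature, `M` satisfies Einstein's equations.) -/
structure IsGravitationalInstanton (M : Type*) [MetricSpace M] (H : Set M) : Prop where
  hyperbolic : IsHyperbolicManifold 4 M
  finite_volume : HasFiniteVolume 4 M
  orientable : IsOrientable 4 M
  totally_geodesic : IsTotallyGeodesicHypersurface 3 H
  hypersurface_orientable : IsOrientable 3 H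
  separating : ¬ IsPreconnected Hᶜ
  reflection : ∃ θ : M ≃ᵢ M, Function.Involutive θ ∧ IsOrientationReversing 4 θ ∧
    Function.fixedPoints θ = H

/-! Let τ be the map of M that exchanges the two points of each fibre of p. If τ preserved
orientation, the orientation of M would descend to N, so τ reverses it
(`IsSheetSwap.relativeSign_eq_neg_one`). Both directions pass through a half (`IsHalf`): an open set
D such that M \ Σ is the disjoint union of D and τ D.

Suppose Σ separates M and is connected. The double cover M \ Σ of the connected set N \ S is
disconnected, so it splits into two sheets exchanged by τ: a half (`IsSheetSwap.exists_isHalf`).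
Since p identifies D with N \ S, the latter is orientable. As S and M are connected, D and τ D lie
on opposite sides of Σ at every point of Σ (`IsHalf.mem_closure`), so D coorients Σ. Since τ
reverses both this coorientation and the orientation of M, the induced orientation of Σ descends to
S (`IsHalf.isOrientable_hypersurface`). If S had two sides, then which of them D lies over would be
locally constant along Σ but changed by τ, against the connectedness of Σ (`IsHalf.isOneSided`).

Conversely, let N \ S be orientable. The points of M \ Σ at which p preserves orientation form a
half D, because τ reverses orientation (`IsSheetSwap.exists_isHalf_of_isOrientable`); hence Σ
separates. Let θ be the lift of ρ that fixes Σ pointwise and exchanges D with τ D. Near S the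
isometry ρ is the reflection in S, so θ is continuous across Σ; it is an involutive local isometry,
hence an isometry, and it reverses orientation because it is a reflection at Σ. If Σ were
disconnected, a neighbourhood of one of its sheets would project injectively to N, and the images of
its parts in D and τ D would be two sides of S (`IsHalf.isPreconnected_preimage`).

Charts are only metric isometries. In the hyperboloid model distance preserving maps are linear
(`exists_lorentz_transformation`), so coordinate changes are C¹ with nonzero Jacobian. Their signs
are therefore locally constant and multiplicative, and all orientation arguments are computations
with these signs. -/

open Filter Topology

/-! ### The hyperboloid model and Lorentz transformations. -/

/-- The Lorentzian bilinear form on `E × ℝ`. -/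
noncomputable def lorentzForm (E : Type*) [NormedAddCommGroup E] [InnerProductSpace ℝ E] :
    (E × ℝ) →ₗ[ℝ] (E × ℝ) →ₗ[ℝ] ℝ :=
  LinearMap.mk₂ ℝ (fun a b => inner ℝ a.1 b.1 - a.2 * b.2)
    (fun a b c => by simp [inner_add_left]; ring)
    (fun r a b => by simp [inner_smul_left]; ring)
    (fun a b c => by simp [inner_add_right]; ring)
    (fun r a b => by simp [inner_smul_right]; ring)

/-- The map from the conformal ball model to the hyperboloid model. -/
noncomputable def hyperboloidLift {E : Type*} [NormedAddCommGroup E] [InnerProductSpace ℝ E]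
    (x : E) : E × ℝ :=
  ((2 / (1 - ‖x‖ ^ 2)) • x, (1 + ‖x‖ ^ 2) / (1 - ‖x‖ ^ 2))

theorem one_sub_norm_sq_pos {E : Type*} [NormedAddCommGroup E] {x : E} (hx : x ∈ Metric.ball (0 : E) 1) : 0 < 1 - ‖x‖ ^ 2 := by
  have h : ‖x‖ < 1 := by simpa using hx
  nlinarith [norm_nonneg x]

section Lorentz

variable {E : Type*} [NormedAddCommGroup E] [InnerProductSpace ℝ E]

theorem lorentzForm_apply (a b : E × ℝ) :
    lorentzForm E a b = inner ℝ a.1 b.1 - a.2 * b.2 := rfl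

/-- The right side is minus the hyperbolic cosine of the distance, so preserving distances means
preserving the form. -/
theorem lorentzForm_hyperboloidLift {x y : E} (hx : x ∈ Metric.ball (0 : E) 1)
    (hy : y ∈ Metric.ball (0 : E) 1) :
    lorentzForm E (hyperboloidLift x) (hyperboloidLift y) =
      -(1 + 2 * ‖x - y‖ ^ 2 / ((1 - ‖x‖ ^ 2) * (1 - ‖y‖ ^ 2))) := by
  have h1 := (one_sub_norm_sq_pos hx).ne'
  have h2 := (one_sub_norm_sq_pos hy).ne'
  rw [lorentzForm_apply, norm_sub_sq_real]
  simp only [hyperboloidLift, inner_smul_left, inner_smul_right, conj_trivial]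
  field_simp
  ring

/-- This is stereographic projection back to the ball, which inverts the lift. -/
theorem hyperboloidLift_fst {x : E} (hx : x ∈ Metric.ball (0 : E) 1) :
    (1 + (hyperboloidLift x).2)⁻¹ • (hyperboloidLift x).1 = x := by
  have h1 := (one_sub_norm_sq_pos hx).ne'
  have : (1 + (1 + ‖x‖ ^ 2) / (1 - ‖x‖ ^ 2)) = 2 / (1 - ‖x‖ ^ 2) := by
    field_simp; ring
  simp only [hyperboloidLift, this, smul_smul]
  rw [inv_mul_cancel₀ (div_ne_zero two_ne_zero h1), one_smul]

theorem hyperboloidLift_snd_pos {x : E} (hx : x ∈ Metric.ball (0 : E) 1) :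
    0 < 1 + (hyperboloidLift x).2 := by
  have h1 := (one_sub_norm_sq_pos hx)
  simp only [hyperboloidLift]
  positivity

theorem hyperboloidLift_injOn :
    Set.InjOn (hyperboloidLift : E → E × ℝ) (Metric.ball 0 1) := fun x hx y hy h => by
  rw [← hyperboloidLift_fst hx, ← hyperboloidLift_fst hy, h]

theorem contDiffAt_hyperboloidLift {x : E} (hx : x ∈ Metric.ball (0 : E) 1) :
    ContDiffAt ℝ 1 (hyperboloidLift : E → E × ℝ) x := by
  have h1 := (one_sub_norm_sq_pos hx).ne'
  have h2 : ContDiffAt ℝ 1 (fun x : E => ‖x‖ ^ 2) x := contDiffAt_id.norm_sq ℝ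
  have h3 : ContDiffAt ℝ 1 (fun x : E => 1 - ‖x‖ ^ 2) x := contDiffAt_const.sub h2
  exact ((contDiffAt_const.div h3 h1).smul contDiffAt_id).prodMk
    ((contDiffAt_const.add h2).div h3 h1)

theorem lorentzForm_nondegenerate {w : E × ℝ} (h : ∀ v, lorentzForm E w v = 0) : w = 0 := by
  have h1 := h (w.1, 0)
  have h2 := h (0, 1)
  simp [lorentzForm_apply] at h1 h2
  exact Prod.ext h1 h2

theorem eq_zero_of_eventually_quadratic {a b c : ℝ}
    (h : ∀ᶠ t : ℝ in 𝓝 0, a + b * t + c * t ^ 2 = 0) : a = 0 ∧ b = 0 ∧ c = 0 := by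
  obtain ⟨ε, hε, H⟩ := Metric.eventually_nhds_iff.1 h
  have h0 := @H 0 (by simpa using hε)
  have h1 := @H (ε / 2) (by rw [Real.dist_eq, sub_zero, abs_of_pos] <;> linarith)
  have h2 := @H (-(ε / 2)) (by rw [Real.dist_eq, sub_zero, abs_neg, abs_of_pos] <;> linarith)
  have ha : a = 0 := by simpa using h0
  subst ha
  have hb : b * ε = 0 := by linarith
  have hc : c * ε ^ 2 = 0 := by nlinarith
  refine ⟨rfl, ?_, ?_⟩
  · exact (mul_eq_zero.1 hb).resolve_right hε.ne'
  · exact (mul_eq_zero.1 hc).resolve_right (pow_ne_zero _ hε.ne')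

/-- A linear functional that vanishes on the lifts gives, after clearing denominators, a polynomial
of degree two in v that vanishes on an open set; its coefficients along every line are zero. -/
theorem span_hyperboloidLift_image [FiniteDimensional ℝ E] {O : Set E} (hO : IsOpen O)
    (hne : O.Nonempty) (hb : O ⊆ Metric.ball 0 1) :
    Submodule.span ℝ (hyperboloidLift '' O) = ⊤ := by
  by_contra hlt
  obtain ⟨f, f0, hf⟩ := Submodule.exists_le_ker_of_lt_top _ (lt_top_iff_ne_top.2 hlt)
  apply f0
  obtain ⟨u, hu⟩ := hne
  set c := f (0, 1)
  have key : ∀ v ∈ O, 2 * f (v, 0) + (1 + ‖v‖ ^ 2) * c = 0 := by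
    intro v hv
    have h1 := one_sub_norm_sq_pos (hb hv)
    have h2 : f (hyperboloidLift v) = 0 := hf (Submodule.subset_span ⟨v, hv, rfl⟩)
    have h3 : hyperboloidLift v = (2 / (1 - ‖v‖ ^ 2)) • ((v, 0) : E × ℝ) +
        ((1 + ‖v‖ ^ 2) / (1 - ‖v‖ ^ 2)) • ((0, 1) : E × ℝ) := by
      simp [hyperboloidLift]
    rw [h3, map_add, map_smul, map_smul, smul_eq_mul, smul_eq_mul] at h2
    field_simp at h2
    linarith
  have key2 : ∀ h : E, c * ‖h‖ ^ 2 = 0 ∧ 2 * f (h, 0) + 2 * inner ℝ u h * c = 0 := by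
    intro h
    have hev : ∀ᶠ t : ℝ in 𝓝 0, u + t • h ∈ O := by
      have : ContinuousAt (fun t : ℝ => u + t • h) 0 := by fun_prop
      exact this.preimage_mem_nhds (by simpa using hO.mem_nhds hu)
    have : ∀ᶠ t : ℝ in 𝓝 0, (2 * f (u, 0) + (1 + ‖u‖ ^ 2) * c) +
        (2 * f (h, 0) + 2 * inner ℝ u h * c) * t + (c * ‖h‖ ^ 2) * t ^ 2 = 0 := by
      filter_upwards [hev] with t ht
      have h1 := key _ ht
      have h2 : ((u + t • h, 0) : E × ℝ) = (u, 0) + t • (h, 0) := by simp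
      rw [h2, map_add, map_smul, norm_add_sq_real, inner_smul_right, norm_smul, mul_pow,
        Real.norm_eq_abs, sq_abs, smul_eq_mul] at h1
      linarith
    have := eq_zero_of_eventually_quadratic this
    exact ⟨this.2.2, this.2.1⟩
  -- If c were nonzero, `key2` would make every vector zero, and `key` at u = 0 would then give c =
  -- 0. This covers the case of dimension zero.
  have hc : c = 0 := by
    by_contra hc
    have hz : ∀ h : E, h = 0 := fun h => by
      have := (mul_eq_zero.1 (key2 h).1).resolve_left hc
      simpa using this
    have := key u hu
    rw [hz u] at this
    have h0 : f ((0 : E), (0 : ℝ)) = 0 := map_zero f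
    rw [h0] at this
    simp at this
    exact hc this
  refine LinearMap.ext fun w => ?_
  have hw : w = (w.1, 0) + w.2 • ((0, 1) : E × ℝ) := by simp
  have h1 := (key2 w.1).2
  rw [hc] at h1
  rw [hw, map_add, map_smul]
  change _ + w.2 • c = 0
  rw [hc]
  simp; linarith

/-- A map that preserves the distance of hyperbolic space on an open set is, in the hyperboloid
model, the restriction of a Lorentz transformation. -/
theorem exists_lorentz_transformation [FiniteDimensional ℝ E] {O : Set E} (hO : IsOpen O)
    (hne : O.Nonempty) (hb : O ⊆ Metric.ball 0 1) {g : E → E}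
    (hg : ∀ u ∈ O, ∀ v ∈ O,
      lorentzForm E (hyperboloidLift (g u)) (hyperboloidLift (g v)) =
        lorentzForm E (hyperboloidLift u) (hyperboloidLift v)) :
    ∃ A : (E × ℝ) ≃ₗ[ℝ] (E × ℝ), (∀ a b, lorentzForm E (A a) (A b) = lorentzForm E a b) ∧
      ∀ v ∈ O, hyperboloidLift (g v) = A (hyperboloidLift v) := by
  have hs := (span_hyperboloidLift_image hO hne hb).ge
  let b := Module.Basis.ofSpan hs
  have hbO : ∀ i, ∃ u ∈ O, hyperboloidLift u = b i := fun i =>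
    Module.Basis.ofSpan_subset hs ⟨i, rfl⟩
  choose u huO hu using hbO
  -- The basis b consists of lifts of points of O, so g prescribes A on it.
  let A := b.constr ℝ (fun i => hyperboloidLift (g (u i)))
  have hA : ∀ i, A (b i) = hyperboloidLift (g (u i)) := fun i => b.constr_basis ℝ _ i
  have hpres : (lorentzForm E).compl₁₂ A A = lorentzForm E :=
    b.ext fun i => b.ext fun j => by
      simp only [LinearMap.compl₁₂_apply, hA]
      rw [hg _ (huO i) _ (huO j), hu, hu]
  have hpres' : ∀ a b, lorentzForm E (A a) (A b) = lorentzForm E a b := fun a b =>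
    LinearMap.congr_fun (LinearMap.congr_fun hpres a) b
  have hinj : Function.Injective A := by
    rw [injective_iff_map_eq_zero]
    intro a ha
    refine lorentzForm_nondegenerate fun v => ?_
    rw [← hpres', ha, map_zero, LinearMap.zero_apply]
  have hsurj : Function.Surjective A := LinearMap.surjective_of_injective hinj
  refine ⟨LinearEquiv.ofBijective A ⟨hinj, hsurj⟩, hpres', fun v hv => ?_⟩
  change hyperboloidLift (g v) = A (hyperboloidLift v)
  rw [← sub_eq_zero]
  -- By surjectivity of A it suffices to pair with vectors A z, and by linearity with the images of
  -- the basis, where the pairing is known from g.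
  refine lorentzForm_nondegenerate fun z => ?_
  obtain ⟨z, rfl⟩ := hsurj z
  have : (lorentzForm E (hyperboloidLift (g v) - A (hyperboloidLift v))).comp A = 0 :=
    b.ext fun i => by
      rw [LinearMap.comp_apply, map_sub, LinearMap.sub_apply, hpres', hA,
        hg _ hv _ (huO i), hu]
      simp
  exact LinearMap.congr_fun this z

end Lorentz

theorem continuousLinearMap_det_comp {F : Type*} [NormedAddCommGroup F] [NormedSpace ℝ F]
    (A B : F →L[ℝ] F) : (A.comp B).det = A.det * B.det :=
  LinearMap.det_comp _ _

/-! ### Smoothness of local hyperbolic isometries. -/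

section HypDist

variable {n : ℕ}

local notation "𝔼" n => EuclideanSpace ℝ (Fin n)

theorem lorentzForm_eq_of_hypDist_eq {x y x' y' : 𝔼 n} (hx : x ∈ Metric.ball (0 : 𝔼 n) 1)
    (hy : y ∈ Metric.ball (0 : 𝔼 n) 1) (hx' : x' ∈ Metric.ball (0 : 𝔼 n) 1)
    (hy' : y' ∈ Metric.ball (0 : 𝔼 n) 1) (h : hypDist x y = hypDist x' y') :
    lorentzForm (𝔼 n) (hyperboloidLift x) (hyperboloidLift y) =
      lorentzForm (𝔼 n) (hyperboloidLift x') (hyperboloidLift y') := by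
  rw [lorentzForm_hyperboloidLift hx hy, lorentzForm_hyperboloidLift hx' hy', neg_inj]
  have h1 := one_sub_norm_sq_pos hx
  have h2 := one_sub_norm_sq_pos hy
  have h3 := one_sub_norm_sq_pos hx'
  have h4 := one_sub_norm_sq_pos hy'
  refine Real.arcosh_injOn ?_ ?_ h
  · rw [Set.mem_Ici, le_add_iff_nonneg_right]; positivity
  · rw [Set.mem_Ici, le_add_iff_nonneg_right]; positivity

/-- `g` preserves the hyperbolic distance on a neighbourhood of `u` in the ball. -/
def HypIsoAt (g : (𝔼 n) → (𝔼 n)) (u : 𝔼 n) : Prop :=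
  ∃ O : Set (𝔼 n), IsOpen O ∧ u ∈ O ∧ O ⊆ Metric.ball 0 1 ∧ Set.MapsTo g O (Metric.ball 0 1) ∧
    ∀ x ∈ O, ∀ y ∈ O, hypDist (g x) (g y) = hypDist x y

theorem HypIsoAt.exists_linear {g : (𝔼 n) → (𝔼 n)} {u : 𝔼 n} (h : HypIsoAt g u) :
    ∃ A : ((𝔼 n) × ℝ) ≃ₗ[ℝ] ((𝔼 n) × ℝ),
      (∀ a b, lorentzForm (𝔼 n) (A a) (A b) = lorentzForm (𝔼 n) a b) ∧
      ∀ᶠ v in 𝓝 u, v ∈ Metric.ball (0 : 𝔼 n) 1 ∧ g v ∈ Metric.ball (0 : 𝔼 n) 1 ∧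
        hyperboloidLift (g v) = A (hyperboloidLift v) := by
  obtain ⟨O, hO, hu, hb, hm, hd⟩ := h
  obtain ⟨A, hA, hgA⟩ := exists_lorentz_transformation hO ⟨u, hu⟩ hb (g := g)
    fun x hx y hy => lorentzForm_eq_of_hypDist_eq (hm hx) (hm hy) (hb hx) (hb hy) (hd x hx y hy)
  refine ⟨A, hA, ?_⟩
  filter_upwards [hO.mem_nhds hu] with v hv
  exact ⟨hb hv, hm hv, hgA v hv⟩

/-- The projection of a linearly transformed point of the hyperboloid to the ball is smooth. -/
theorem contDiffAt_ballProjection (A : ((𝔼 n) × ℝ) ≃ₗ[ℝ] ((𝔼 n) × ℝ)) {u v : 𝔼 n}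
    (hu : u ∈ Metric.ball (0 : 𝔼 n) 1) (hv : v ∈ Metric.ball (0 : 𝔼 n) 1)
    (h : hyperboloidLift v = A (hyperboloidLift u)) :
    ContDiffAt ℝ 1
      (fun v => (1 + (A (hyperboloidLift v)).2)⁻¹ • (A (hyperboloidLift v)).1) u := by
  have h1 : ContDiffAt ℝ 1 (fun v : 𝔼 n => A (hyperboloidLift v)) u :=
    (A.toLinearMap.toContinuousLinearMap.contDiff.contDiffAt).comp u
      (contDiffAt_hyperboloidLift hu)
  refine ContDiffAt.smul (ContDiffAt.inv (contDiffAt_const.add h1.snd) ?_) h1.fst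
  rw [← h]
  exact (hyperboloidLift_snd_pos hv).ne'

/-- Near u the map is lift, then a linear map, then stereographic projection. -/
theorem HypIsoAt.contDiffAt {g : (𝔼 n) → (𝔼 n)} {u : 𝔼 n} (h : HypIsoAt g u) :
    ContDiffAt ℝ 1 g u := by
  obtain ⟨A, -, hA⟩ := h.exists_linear
  have hu := hA.self_of_nhds
  refine (contDiffAt_ballProjection A hu.1 hu.2.1 hu.2.2).congr_of_eventuallyEq ?_
  filter_upwards [hA] with v hv
  rw [← hv.2.2, hyperboloidLift_fst hv.2.1]

theorem HypIsoAt.differentiableAt {g : (𝔼 n) → (𝔼 n)} {u : 𝔼 n} (h : HypIsoAt g u) :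
    DifferentiableAt ℝ g u :=
  h.contDiffAt.differentiableAt one_ne_zero

/-- The inverse Lorentz transformation supplies a differentiable local left inverse; the chain rule
does the rest. -/
theorem HypIsoAt.det_ne_zero {g : (𝔼 n) → (𝔼 n)} {u : 𝔼 n} (h : HypIsoAt g u) :
    (fderiv ℝ g u).det ≠ 0 := by
  obtain ⟨A, -, hA⟩ := h.exists_linear
  have hu := hA.self_of_nhds
  have h1 := (contDiffAt_ballProjection A.symm hu.2.1 hu.1
    (by rw [hu.2.2, A.symm_apply_apply])).differentiableAt one_ne_zero
  set k : (𝔼 n) → (𝔼 n) :=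
    fun v => (1 + (A.symm (hyperboloidLift v)).2)⁻¹ • (A.symm (hyperboloidLift v)).1 with hk
  have h2 : k ∘ g =ᶠ[𝓝 u] id := by
    filter_upwards [hA] with v hv
    simp only [hk, Function.comp_apply, hv.2.2, A.symm_apply_apply, hyperboloidLift_fst hv.1, id]
  have h3 := h2.fderiv_eq (𝕜 := ℝ)
  rw [fderiv_comp u h1 h.differentiableAt, fderiv_id] at h3
  intro h0
  have h4 := congrArg ContinuousLinearMap.det h3
  rw [continuousLinearMap_det_comp, h0, mul_zero] at h4
  exact zero_ne_one (α := ℝ) (h4.trans LinearMap.det_id)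

theorem HypIsoAt.continuousAt_det {g : (𝔼 n) → (𝔼 n)} {u : 𝔼 n} (h : HypIsoAt g u) :
    ContinuousAt (fun v => (fderiv ℝ g v).det) u :=
  ContinuousLinearMap.continuous_det.continuousAt.comp
    (h.contDiffAt.fderiv_right (m := 0) (by norm_num)).continuousAt

end HypDist

/-! ### Local isometries and the signs of their Jacobians in charts. -/

section Signs

variable {n : ℕ} {X Y Z : Type*} [MetricSpace X] [MetricSpace Y] [MetricSpace Z]

local notation "𝔼" n => EuclideanSpace ℝ (Fin n)

/-- A local isometry: an open map which locally preserves the distance. -/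
structure IsLocalIsometry (f : X → Y) : Prop where
  isOpenMap : IsOpenMap f
  dist_eq : ∀ x, ∃ U ∈ 𝓝 x, ∀ y ∈ U, ∀ z ∈ U, dist (f y) (f z) = dist y z

theorem IsLocalIsometry.continuous {f : X → Y} (hf : IsLocalIsometry f) : Continuous f := by
  rw [continuous_iff_continuousAt]
  intro x
  obtain ⟨U, hU, h⟩ := hf.dist_eq x
  rw [Metric.continuousAt_iff']
  intro ε hε
  filter_upwards [hU, Metric.ball_mem_nhds x hε] with y hy hy'
  rw [h y hy x (mem_of_mem_nhds hU)]
  exact hy'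

theorem IsLocalIsometry.exists_isOpen {f : X → Y} (hf : IsLocalIsometry f) (x : X) :
    ∃ U, IsOpen U ∧ x ∈ U ∧ ∀ y ∈ U, ∀ z ∈ U, dist (f y) (f z) = dist y z := by
  obtain ⟨U, hU, h⟩ := hf.dist_eq x
  obtain ⟨V, hVU, hV, hx⟩ := mem_nhds_iff.1 hU
  exact ⟨V, hV, hx, fun y hy z hz => h y (hVU hy) z (hVU hz)⟩

theorem IsLocalIsometry.map_nhds {f : X → Y} (hf : IsLocalIsometry f) (x : X) :
    map f (𝓝 x) = 𝓝 (f x) :=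
  le_antisymm hf.continuous.continuousAt (hf.isOpenMap.nhds_le x)

theorem IsLocalIsometry.comp {f : X → Y} {g : Y → Z} (hg : IsLocalIsometry g)
    (hf : IsLocalIsometry f) : IsLocalIsometry (g ∘ f) where
  isOpenMap := hg.isOpenMap.comp hf.isOpenMap
  dist_eq x := by
    obtain ⟨U, hU, h⟩ := hf.dist_eq x
    obtain ⟨V, hV, h'⟩ := hg.dist_eq (f x)
    refine ⟨U ∩ f ⁻¹' V, inter_mem hU (hf.continuous.continuousAt.preimage_mem_nhds hV), ?_⟩
    intro y hy z hz
    rw [Function.comp_apply, Function.comp_apply, h' _ hy.2 _ hz.2, h _ hy.1 _ hz.1]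

/-- A continuous lift of a local isometry along a local isometry is a local isometry. -/
theorem IsLocalIsometry.of_comp {f : X → Y} {p : Y → Z} (hp : IsLocalIsometry p)
    (hf : Continuous f) (hpf : IsLocalIsometry (p ∘ f)) : IsLocalIsometry f where
  isOpenMap := by
    rw [isOpenMap_iff_nhds_le]
    intro x
    obtain ⟨V, hV, h⟩ := hp.dist_eq (f x)
    intro W hW
    have h1 : f ⁻¹' V ∩ f ⁻¹' W ∈ 𝓝 x := inter_mem (hf.continuousAt.preimage_mem_nhds hV) hW
    have h2 : (p ∘ f) '' (f ⁻¹' V ∩ f ⁻¹' W) ∈ 𝓝 (p (f x)) := by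
      have := image_mem_map (m := p ∘ f) h1
      rwa [hpf.map_nhds] at this
    filter_upwards [hV, hp.continuous.continuousAt.preimage_mem_nhds h2] with y hyV hy
    obtain ⟨z, hz, hzy⟩ := hy
    -- Both points lie in V, on which p preserves distances, and p maps them to the same point.
    have : f z = y := by
      rw [← dist_eq_zero, ← h _ hz.1 _ hyV, dist_eq_zero]
      exact hzy
    exact this ▸ hz.2
  dist_eq x := by
    obtain ⟨U, hU, h⟩ := hpf.dist_eq x
    obtain ⟨V, hV, h'⟩ := hp.dist_eq (f x)
    refine ⟨U ∩ f ⁻¹' V, inter_mem hU (hf.continuousAt.preimage_mem_nhds hV), ?_⟩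
    intro y hy z hz
    rw [← h' _ hy.2 _ hz.2, ← h _ hy.1 _ hz.1]
    rfl

theorem IsLocalIsometry.id : IsLocalIsometry (fun x : X => x) :=
  ⟨IsOpenMap.id, fun _ => ⟨Set.univ, univ_mem, fun _ _ _ _ => rfl⟩⟩

theorem IsLocalIsometry.subtype_val {U : Set X} (hU : IsOpen U) :
    IsLocalIsometry (Subtype.val : U → X) :=
  ⟨hU.isOpenMap_subtype_val, fun _ => ⟨Set.univ, univ_mem, fun _ _ _ _ => rfl⟩⟩

theorem IsometryEquiv.isLocalIsometry (f : X ≃ᵢ Y) : IsLocalIsometry f :=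
  ⟨f.toHomeomorph.isOpenMap, fun _ => ⟨Set.univ, univ_mem, fun _ _ _ _ => f.dist_eq _ _⟩⟩

theorem IsLocalIsometry.restrictPreimage {f : X → Y} (hf : IsLocalIsometry f) (S : Set Y) :
    IsLocalIsometry (S.restrictPreimage f) where
  isOpenMap := hf.isOpenMap.restrictPreimage S
  dist_eq x := by
    obtain ⟨U, hU, h⟩ := hf.dist_eq x.1
    exact ⟨Subtype.val ⁻¹' U, continuous_subtype_val.continuousAt.preimage_mem_nhds hU,
      fun y hy z hz => h y hy z hz⟩

theorem IsLocalIsometry.exists_openPartialHomeomorph {f : X → Y} (hf : IsLocalIsometry f)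
    (x : X) : ∃ φ : OpenPartialHomeomorph X Y, x ∈ φ.source ∧ (∀ y, φ y = f y) ∧
      ∀ y ∈ φ.source, ∀ z ∈ φ.source, dist (f y) (f z) = dist y z := by
  obtain ⟨U, hU, hx, h⟩ := hf.exists_isOpen x
  have hinj : Set.InjOn f U := fun y hy z hz hyz => by
    rw [← dist_eq_zero, ← h y hy z hz, hyz, dist_self]
  have : Nonempty X := ⟨x⟩
  exact ⟨OpenPartialHomeomorph.ofContinuousOpenRestrict (hinj.toPartialEquiv f U)
    hf.continuous.continuousOn (hf.isOpenMap.comp hU.isOpenMap_subtype_val) hU,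
    hx, fun _ => rfl, h⟩

/-- The sign with which `f` transforms the orientations of the charts `e` and `e'` at `x`. -/
noncomputable def orientationSign (f : X → Y) (e : OpenPartialHomeomorph X (𝔼 n))
    (e' : OpenPartialHomeomorph Y (𝔼 n)) (x : X) : SignType :=
  SignType.sign (fderiv ℝ (fun v => e' (f (e.symm v))) (e x)).det

variable {f : X → Y} {g : Y → Z} {e : OpenPartialHomeomorph X (𝔼 n)}
  {e' : OpenPartialHomeomorph Y (𝔼 n)} {e'' : OpenPartialHomeomorph Z (𝔼 n)} {x : X}

theorem IsLocalIsometry.hypIsoAt (hf : IsLocalIsometry f) (he : IsHyperbolicChart n e)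
    (he' : IsHyperbolicChart n e') (hx : x ∈ e.source) (hfx : f x ∈ e'.source) :
    HypIsoAt (fun v => e' (f (e.symm v))) (e x) := by
  obtain ⟨U, hU, hxU, h⟩ := hf.exists_isOpen x
  have hO := e.isOpen_inter_preimage_symm (hU.inter (e'.open_source.preimage hf.continuous))
  refine ⟨_, hO, ⟨e.map_source hx, ?_⟩, fun v hv => he.target_subset hv.1,
    fun v hv => he'.target_subset (e'.map_source hv.2.2), ?_⟩
  · rw [Set.mem_preimage, e.left_inv hx]
    exact ⟨hxU, hfx⟩
  · intro v hv w hw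
    rw [← he'.dist_eq _ hv.2.2 _ hw.2.2, h _ hv.2.1 _ hw.2.1,
      he.dist_eq _ (e.map_target hv.1) _ (e.map_target hw.1), e.right_inv hv.1, e.right_inv hw.1]

theorem orientationSign_ne_zero (hf : IsLocalIsometry f) (he : IsHyperbolicChart n e)
    (he' : IsHyperbolicChart n e') (hx : x ∈ e.source) (hfx : f x ∈ e'.source) :
    orientationSign f e e' x ≠ 0 :=
  sign_ne_zero.2 (hf.hypIsoAt he he' hx hfx).det_ne_zero

theorem eventually_sign_eq {α : Type*} {l : Filter α} {u : α → ℝ} {c : ℝ} (h : Tendsto u l (𝓝 c))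
    (hc : c ≠ 0) : ∀ᶠ a in l, SignType.sign (u a) = SignType.sign c := by
  rcases hc.lt_or_gt with h1 | h1
  · filter_upwards [h.eventually (gt_mem_nhds h1)] with a ha
    rw [sign_neg ha, sign_neg h1]
  · filter_upwards [h.eventually (lt_mem_nhds h1)] with a ha
    rw [sign_pos ha, sign_pos h1]

theorem eventually_orientationSign_eq (hf : IsLocalIsometry f) (he : IsHyperbolicChart n e)
    (he' : IsHyperbolicChart n e') (hx : x ∈ e.source) (hfx : f x ∈ e'.source) :
    ∀ᶠ y in 𝓝 x, orientationSign f e e' y = orientationSign f e e' x := by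
  have h := hf.hypIsoAt he he' hx hfx
  exact eventually_sign_eq (h.continuousAt_det.tendsto.comp (e.continuousAt hx)) h.det_ne_zero

theorem orientationSign_comp (hf : IsLocalIsometry f) (hg : IsLocalIsometry g)
    (he : IsHyperbolicChart n e) (he' : IsHyperbolicChart n e') (he'' : IsHyperbolicChart n e'')
    (hx : x ∈ e.source) (hfx : f x ∈ e'.source) (hgx : g (f x) ∈ e''.source) :
    orientationSign (fun y => g (f y)) e e'' x =
      orientationSign f e e' x * orientationSign g e' e'' (f x) := by
  have h1 := hf.hypIsoAt he he' hx hfx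
  have h2 := hg.hypIsoAt he' he'' hfx hgx
  have h3 : (fun v => e'' (g (f (e.symm v)))) =ᶠ[𝓝 (e x)]
      (fun v => e'' (g (e'.symm v))) ∘ (fun v => e' (f (e.symm v))) := by
    have hc : ContinuousAt (fun v => f (e.symm v)) (e x) :=
      hf.continuous.continuousAt.comp (e.continuousAt_symm (e.map_source hx))
    have : (fun v => f (e.symm v)) (e x) = f x := by simp [e.left_inv hx]
    filter_upwards [hc.preimage_mem_nhds (this ▸ e'.open_source.mem_nhds hfx)] with v hv
    simp only [Function.comp_apply]
    rw [e'.left_inv hv]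
  have hex : e' (f (e.symm (e x))) = e' (f x) := by rw [e.left_inv hx]
  rw [orientationSign, h3.fderiv_eq, fderiv_comp, continuousLinearMap_det_comp, hex, sign_mul,
    mul_comm]
  · rfl
  · rw [hex]; exact h2.differentiableAt
  · exact h1.differentiableAt

/-- By the composition rule this sign equals its own square, and it is not zero. -/
theorem orientationSign_self (he : IsHyperbolicChart n e) (hx : x ∈ e.source) :
    orientationSign (fun y => y) e e x = 1 := by
  have h := orientationSign_comp IsLocalIsometry.id IsLocalIsometry.id he he he hx hx hx
  have h0 := orientationSign_ne_zero IsLocalIsometry.id he he hx hx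
  generalize orientationSign (fun y : X => y) e e x = s at h h0
  revert s; decide

theorem orientationSign_symm {e' : OpenPartialHomeomorph X (𝔼 n)} (he : IsHyperbolicChart n e)
    (he' : IsHyperbolicChart n e') (hx : x ∈ e.source) (hx' : x ∈ e'.source) :
    orientationSign (fun y => y) e' e x = orientationSign (fun y => y) e e' x := by
  have h := orientationSign_comp IsLocalIsometry.id IsLocalIsometry.id he he' he hx hx' hx
  rw [orientationSign_self he hx] at h
  generalize orientationSign (fun y : X => y) e e' x = s at h
  generalize orientationSign (fun y : X => y) e' e x = t at h ⊢
  revert s t; decide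

theorem IsHyperbolicChart.restr (he : IsHyperbolicChart n e) (U : Set X) :
    IsHyperbolicChart n (e.restr U) where
  target_subset := fun _ hv => he.target_subset hv.1
  dist_eq := fun y hy z hz => he.dist_eq y hy.1 z hz.1

/-- Charts that are compatible with the charts of all nearby points make up an orientation. -/
theorem isOrientable_of_charts (c : X → OpenPartialHomeomorph X (𝔼 n))
    (hc : ∀ x, IsHyperbolicChart n (c x)) (hx : ∀ x, x ∈ (c x).source)
    (h : ∀ x, ∀ᶠ y in 𝓝 x, orientationSign (fun y => y) (c x) (c y) y = 1) :
    IsOrientable n X := by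
  -- Each chart is restricted to the interior of the set where it agrees with the chart chosen at
  -- the point itself. Two restricted charts are compared at z through the chart `c z`.
  refine ⟨Set.range fun x =>
    (c x).restr {y | orientationSign (fun y => y) (c x) (c y) y = 1}, ?_, ?_, ?_⟩
  · rintro _ ⟨x, rfl⟩
    exact (hc x).restr _
  · intro x
    refine ⟨_, ⟨x, rfl⟩, ?_⟩
    rw [OpenPartialHomeomorph.restr_source]
    exact ⟨hx x, mem_interior_iff_mem_nhds.2 (h x)⟩
  · rintro _ ⟨x, rfl⟩ _ ⟨y, rfl⟩ z hz hz'
    rw [OpenPartialHomeomorph.restr_source] at hz hz'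
    have h1 : orientationSign (fun y => y) (c x) (c z) z = 1 :=
      interior_subset (s := {y | orientationSign (fun y => y) (c x) (c y) y = 1}) hz.2
    have h2 : orientationSign (fun y => y) (c y) (c z) z = 1 :=
      interior_subset (s := {z | orientationSign (fun y => y) (c y) (c z) z = 1}) hz'.2
    rw [← orientationSign_symm (hc y) (hc z) hz'.1 (hx z)] at h2
    have h3 := orientationSign_comp IsLocalIsometry.id IsLocalIsometry.id (hc x) (hc z) (hc y)
      hz.1 (hx z) hz'.1
    rw [h1, h2, one_mul] at h3
    exact sign_eq_one_iff.1 h3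

end Signs

/-! ### Reflections and isometries fixing a hyperplane. -/

section Reflections

variable {n : ℕ}

local notation "𝔼" n => EuclideanSpace ℝ (Fin n)

/-- The reflection of Euclidean space in the `i`-th coordinate. -/
noncomputable def coordReflection (i : Fin n) : (𝔼 n) ≃ₗᵢ[ℝ] (𝔼 n) :=
  (ℝ ∙ (EuclideanSpace.single i (1 : ℝ)))ᗮ.reflection

theorem coordReflection_eq (i : Fin n) (v : 𝔼 n) :
    coordReflection i v = v - (2 * v i) • EuclideanSpace.single i (1 : ℝ) := by
  rw [coordReflection, Submodule.reflection_orthogonal_apply,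
    Submodule.reflection_singleton_apply]
  simp only [EuclideanSpace.inner_single_left, map_one, one_mul, PiLp.norm_single, norm_one]
  simp [two_mul, add_smul, two_smul]

theorem coordReflection_apply_self (i : Fin n) (v : 𝔼 n) : coordReflection i v i = -v i := by
  rw [coordReflection_eq]
  simp
  ring

theorem coordReflection_apply_of_ne {i j : Fin n} (h : j ≠ i) (v : 𝔼 n) :
    coordReflection i v j = v j := by
  rw [coordReflection_eq]
  simp [h]

theorem det_coordReflection (i : Fin n) :
    ((coordReflection i : (𝔼 n) ≃L[ℝ] (𝔼 n)) : (𝔼 n) →L[ℝ] (𝔼 n)).det = -1 := by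
  have h := Submodule.det_reflection (ℝ ∙ (EuclideanSpace.single i (1 : ℝ)))ᗮ
  have h1 : Module.finrank ℝ (ℝ ∙ (EuclideanSpace.single i (1 : ℝ)))ᗮᗮ = 1 := by
    rw [Submodule.orthogonal_orthogonal, finrank_span_singleton (by simp)]
  rw [h1, pow_one] at h
  exact h

/-- The inclusion of the hyperplane on which the last coordinate vanishes. -/
noncomputable def hyperplaneIncl (n : ℕ) : (𝔼 n) →L[ℝ] (𝔼 (n + 1)) :=
  LinearMap.toContinuousLinearMap
    { toFun := fun v => WithLp.toLp 2 (Fin.snoc (α := fun _ => ℝ) v 0)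
      map_add' := fun v w => by
        ext i
        refine Fin.lastCases ?_ (fun j => ?_) i <;> simp
      map_smul' := fun r v => by
        ext i
        refine Fin.lastCases ?_ (fun j => ?_) i <;> simp }

/-- The projection that forgets the last coordinate. -/
noncomputable def hyperplaneProj (n : ℕ) : (𝔼 (n + 1)) →L[ℝ] (𝔼 n) :=
  LinearMap.toContinuousLinearMap
    { toFun := fun v => WithLp.toLp 2 fun i => v i.castSucc
      map_add' := fun v w => by ext i; simp
      map_smul' := fun r v => by ext i; simp }

@[simp] theorem hyperplaneIncl_last (v : 𝔼 n) : hyperplaneIncl n v (Fin.last n) = 0 := by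
  simp [hyperplaneIncl]

@[simp] theorem hyperplaneIncl_castSucc (v : 𝔼 n) (i : Fin n) :
    hyperplaneIncl n v i.castSucc = v i := by
  simp [hyperplaneIncl]

@[simp] theorem hyperplaneProj_apply (v : 𝔼 (n + 1)) (i : Fin n) :
    hyperplaneProj n v i = v i.castSucc := by
  simp [hyperplaneProj]

@[simp] theorem hyperplaneProj_incl (v : 𝔼 n) : hyperplaneProj n (hyperplaneIncl n v) = v := by
  ext i; simp

theorem hyperplaneIncl_proj_add (v : 𝔼 (n + 1)) :
    hyperplaneIncl n (hyperplaneProj n v) +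
      v (Fin.last n) • EuclideanSpace.single (Fin.last n) (1 : ℝ) = v := by
  ext i
  refine Fin.lastCases ?_ (fun j => ?_) i
  · simp
  · simp [(Fin.castSucc_lt_last j).ne]

theorem hyperplaneIncl_proj {v : 𝔼 (n + 1)} (hv : v (Fin.last n) = 0) :
    hyperplaneIncl n (hyperplaneProj n v) = v := by
  have := hyperplaneIncl_proj_add v
  rwa [hv, zero_smul, add_zero] at this

@[simp] theorem norm_hyperplaneIncl (v : 𝔼 n) : ‖hyperplaneIncl n v‖ = ‖v‖ := by
  rw [EuclideanSpace.norm_eq, EuclideanSpace.norm_eq, Fin.sum_univ_castSucc]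
  simp

@[simp] theorem hypDist_hyperplaneIncl (v w : 𝔼 n) :
    hypDist (hyperplaneIncl n v) (hyperplaneIncl n w) = hypDist v w := by
  simp only [hypDist, ← map_sub, norm_hyperplaneIncl]

theorem hypDist_map (R : (𝔼 n) ≃ₗᵢ[ℝ] (𝔼 n)) (v w : 𝔼 n) :
    hypDist (R v) (R w) = hypDist v w := by
  simp only [hypDist, ← map_sub, LinearIsometryEquiv.norm_map]

theorem hyperboloidLift_hyperplaneIncl (v : 𝔼 n) :
    hyperboloidLift (hyperplaneIncl n v) =
      (hyperplaneIncl n).prodMap (ContinuousLinearMap.id ℝ ℝ) (hyperboloidLift v) := by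
  simp [hyperboloidLift]

/-- A hyperbolic isometry that fixes a hyperplane pointwise is locally the identity or the
reflection in that hyperplane. -/
theorem HypIsoAt.eq_or_eq_coordReflection {g : (𝔼 (n + 1)) → (𝔼 (n + 1))} {u : 𝔼 (n + 1)}
    (h : HypIsoAt g u) (hu : u (Fin.last n) = 0)
    (hfix : ∀ᶠ v in 𝓝 u, v (Fin.last n) = 0 → g v = v) :
    (∀ᶠ v in 𝓝 u, g v = v) ∨ ∀ᶠ v in 𝓝 u, g v = coordReflection (Fin.last n) v := by
  obtain ⟨A, hA, hgA⟩ := h.exists_linear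
  set ι := (hyperplaneIncl n).prodMap (ContinuousLinearMap.id ℝ ℝ) with hι
  obtain ⟨O, hOsub, hO, huO⟩ := mem_nhds_iff.1 (hgA.and hfix)
  -- The fixed points of g in the hyperplane have lifts that span the range of ι, so A is the
  -- identity there.
  have hAι : A.toLinearMap.comp ι.toLinearMap = ι.toLinearMap := by
    have hO' : IsOpen (hyperplaneIncl n ⁻¹' O) := hO.preimage (hyperplaneIncl n).continuous
    refine LinearMap.ext_on (span_hyperboloidLift_image hO'
      ⟨hyperplaneProj n u, by rwa [Set.mem_preimage, hyperplaneIncl_proj hu]⟩ ?_) ?_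
    · intro v hv
      have := (hOsub hv).1.1
      simpa using this
    · rintro _ ⟨v, hv, rfl⟩
      have h1 := hOsub hv
      have h2 := h1.1.2.2
      rw [h1.2 (hyperplaneIncl_last v), hyperboloidLift_hyperplaneIncl] at h2
      exact h2.symm
  have hAι' : ∀ w, A (ι w) = ι w := fun w => LinearMap.congr_fun hAι w
  -- This unit vector is normal to the range of ι. As A preserves the form and fixes that range, it
  -- multiplies ε by a scalar c with c² = 1; the two values are the two alternatives.
  set ε : (𝔼 (n + 1)) × ℝ := (EuclideanSpace.single (Fin.last n) (1 : ℝ), 0) with hε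
  have horth : ∀ w, lorentzForm _ (A ε) (ι w) = 0 := fun w => by
    rw [← hAι' w, hA]
    simp [lorentzForm_apply, hε, hι, EuclideanSpace.inner_single_left]
  have hAε : A ε = ((A ε).1 (Fin.last n)) • ε := by
    have h2 : (A ε).2 = 0 := by simpa [lorentzForm_apply, hι] using horth (0, 1)
    have h1 : hyperplaneProj n (A ε).1 = 0 := by
      ext i
      have := horth (EuclideanSpace.single i 1, 0)
      rw [lorentzForm_apply, PiLp.inner_apply, Fin.sum_univ_castSucc] at this
      simpa [hι, Pi.single_apply] using this
    refine Prod.ext ?_ (h2.trans (by simp [hε]))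
    conv_lhs => rw [← hyperplaneIncl_proj_add (A ε).1, h1]
    simp [hε]
  set c := (A ε).1 (Fin.last n)
  have hc : c = 1 ∨ c = -1 := by
    have h1 := hA ε ε
    have h0 : lorentzForm _ ε ε = 1 := by simp [lorentzForm_apply, hε]
    rw [hAε, map_smul, map_smul, LinearMap.smul_apply, h0] at h1
    have h2 : c * c = 1 := by simpa using h1
    exact mul_self_eq_one_iff.1 h2
  have hdec : ∀ (v : 𝔼 (n + 1)), hyperboloidLift v =
      ι (hyperplaneProj n (hyperboloidLift v).1, (hyperboloidLift v).2) +
        (hyperboloidLift v).1 (Fin.last n) • ε := fun v => by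
    refine Prod.ext ?_ (by simp [hι, hε])
    exact (hyperplaneIncl_proj_add _).symm
  rcases hc with hc | hc
  · left
    filter_upwards [hgA] with v hv
    refine hyperboloidLift_injOn hv.2.1 hv.1 ?_
    rw [hv.2.2, hdec v, map_add, map_smul, hAι', hAε, hc, one_smul]
  · right
    filter_upwards [hgA] with v hv
    have hRv : coordReflection (Fin.last n) v ∈ Metric.ball (0 : 𝔼 (n + 1)) 1 := by
      simpa using hv.1
    refine hyperboloidLift_injOn hv.2.1 hRv ?_
    have h1 : hyperboloidLift (coordReflection (Fin.last n) v) = hyperboloidLift v -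
        (2 * (hyperboloidLift v).1 (Fin.last n)) • ε := by
      simp only [hyperboloidLift, LinearIsometryEquiv.norm_map]
      refine Prod.ext ?_ (by simp [hε])
      simp [hε, coordReflection_eq, smul_sub, smul_smul, mul_left_comm]
    rw [h1, hv.2.2]
    have h2 := hdec v
    set a := ι (hyperplaneProj n (hyperboloidLift v).1, (hyperboloidLift v).2) with ha
    have h3 : A (hyperboloidLift v) = a + ((hyperboloidLift v).1 (Fin.last n) * -1) • ε := by
      conv_lhs => rw [h2]
      rw [map_add, map_smul, ha, hAι', hAε, hc, smul_smul]
    rw [h3, ← sub_eq_zero]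
    generalize (hyperboloidLift v).1 (Fin.last n) = t at h2 ⊢
    rw [h2]
    module

/-- The determinant of an endomorphism which preserves the hyperplane on which the last coordinate
vanishes. -/
theorem det_eq_of_preserves_hyperplane (D : (𝔼 (n + 1)) →L[ℝ] (𝔼 (n + 1)))
    (hD : ∀ v, D (hyperplaneIncl n v) (Fin.last n) = 0) :
    D.det = D (EuclideanSpace.single (Fin.last n) 1) (Fin.last n) *
      ((hyperplaneProj n).comp (D.comp (hyperplaneIncl n))).det := by
  have hincl : ∀ i : Fin n, hyperplaneIncl n (EuclideanSpace.single i 1) =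
      EuclideanSpace.single i.castSucc 1 := fun i => by
    ext j
    refine Fin.lastCases ?_ (fun k => ?_) j
    · simp [(Fin.castSucc_lt_last i).ne']
    · simp
  rw [ContinuousLinearMap.det, ContinuousLinearMap.det,
    ← LinearMap.det_toMatrix (EuclideanSpace.basisFun (Fin (n + 1)) ℝ).toBasis,
    ← LinearMap.det_toMatrix (EuclideanSpace.basisFun (Fin n) ℝ).toBasis,
    Matrix.det_succ_row _ (Fin.last n), Fin.sum_univ_castSucc]
  -- In the expansion along the last row only the diagonal entry survives, because the hyperplane is
  -- preserved.
  rw [Finset.sum_eq_zero]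
  · have hs : (-1 : ℝ) ^ ((Fin.last n : ℕ) + (Fin.last n : ℕ)) = 1 := by
      rw [← two_mul, pow_mul]; simp
    rw [zero_add, hs, one_mul]
    congr 1
    congr 1
    ext i j
    rw [LinearMap.toMatrix_apply, Matrix.submatrix_apply, LinearMap.toMatrix_apply]
    simp [hincl]
  · intro i _
    simp only [LinearMap.toMatrix_apply]
    have := hD (EuclideanSpace.single i 1)
    rw [hincl] at this
    simp [this]

end Reflections

/-! ### Reflected and pulled back charts; orientations as choices of charts. -/

section Charts

variable {n : ℕ} {X Y Z : Type*} [MetricSpace X] [MetricSpace Y] [MetricSpace Z]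

local notation "𝔼" n => EuclideanSpace ℝ (Fin n)

/-- The chart `e`, reflected in the `i`-th coordinate. -/
noncomputable def reflectChart (i : Fin n) (e : OpenPartialHomeomorph X (𝔼 n)) :
    OpenPartialHomeomorph X (𝔼 n) :=
  e.transHomeomorph (coordReflection i).toHomeomorph

@[simp] theorem reflectChart_source (i : Fin n) (e : OpenPartialHomeomorph X (𝔼 n)) :
    (reflectChart i e).source = e.source := rfl

@[simp] theorem reflectChart_apply (i : Fin n) (e : OpenPartialHomeomorph X (𝔼 n)) (x : X) :
    reflectChart i e x = coordReflection i (e x) := rfl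

theorem IsHyperbolicChart.reflectChart {e : OpenPartialHomeomorph X (𝔼 n)}
    (he : IsHyperbolicChart n e) (i : Fin n) : IsHyperbolicChart n (reflectChart i e) where
  target_subset := fun v hv => by
    have h1 : (coordReflection i).symm v ∈ e.target := hv
    simpa using he.target_subset h1
  dist_eq := fun x hx y hy => by
    rw [reflectChart_apply, reflectChart_apply, hypDist_map, he.dist_eq x hx y hy]

variable {f : X → Y} {e : OpenPartialHomeomorph X (𝔼 n)} {e' : OpenPartialHomeomorph Y (𝔼 n)}
  {x : X}

theorem orientationSign_reflectChart (i : Fin n) :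
    orientationSign f e (reflectChart i e') x = -orientationSign f e e' x := by
  have h : (fun v => reflectChart i e' (f (e.symm v))) =
      (coordReflection i : (𝔼 n) ≃L[ℝ] (𝔼 n)) ∘ fun v => e' (f (e.symm v)) := rfl
  rw [orientationSign, h, ContinuousLinearEquiv.comp_fderiv, continuousLinearMap_det_comp,
    det_coordReflection, neg_one_mul, Left.sign_neg]
  rfl

/-- The chart of `X` that corresponds to a chart of `Y` under a local isometry. -/
theorem IsLocalIsometry.exists_pullback_chart (hf : IsLocalIsometry f)
    (he' : IsHyperbolicChart n e') (hx : f x ∈ e'.source) :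
    ∃ e : OpenPartialHomeomorph X (𝔼 n), IsHyperbolicChart n e ∧ x ∈ e.source ∧
      (∀ y ∈ e.source, f y ∈ e'.source) ∧ ∀ y, e y = e' (f y) := by
  obtain ⟨φ, hφ, h, hd⟩ := hf.exists_openPartialHomeomorph x
  refine ⟨φ.trans e', ⟨?_, ?_⟩, ?_, ?_, fun y => by simp [h]⟩
  · intro v hv
    rw [OpenPartialHomeomorph.trans_target] at hv
    exact he'.target_subset hv.1
  · intro y hy z hz
    rw [OpenPartialHomeomorph.trans_source] at hy hz
    rw [← hd y hy.1 z hz.1, ← h, ← h, he'.dist_eq _ hy.2 _ hz.2]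
    rfl
  · rw [OpenPartialHomeomorph.trans_source]
    exact ⟨hφ, by rwa [Set.mem_preimage, h]⟩
  · intro y hy
    rw [OpenPartialHomeomorph.trans_source] at hy
    rw [← h]
    exact hy.2

theorem orientationSign_pullback (hx : x ∈ e.source) (h : ∀ y, e y = e' (f y)) :
    orientationSign f e e' x = 1 := by
  have h1 : (fun v => e' (f (e.symm v))) =ᶠ[𝓝 (e x)] id := by
    filter_upwards [e.open_target.mem_nhds (e.map_source hx)] with v hv
    rw [← h, e.right_inv hv]
    rfl
  have h2 : (ContinuousLinearMap.id ℝ (𝔼 n)).det = 1 := LinearMap.det_id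
  rw [orientationSign, h1.fderiv_eq, fderiv_id, h2, sign_one]

/-- A choice of charts, one around each point, that belong to one orientation. -/
structure IsOrientedChoice (c : X → OpenPartialHomeomorph X (𝔼 n)) : Prop where
  chart : ∀ x, IsHyperbolicChart n (c x)
  mem_source : ∀ x, x ∈ (c x).source
  compatible : ∀ x, ∀ y ∈ (c x).source, orientationSign (fun y => y) (c x) (c y) y = 1

theorem IsOrientedAtlas.exists_choice
    {A : Set (OpenPartialHomeomorph X (𝔼 n))} (hA : IsOrientedAtlas n A) :
    ∃ c : X → OpenPartialHomeomorph X (𝔼 n), IsOrientedChoice c ∧ ∀ x, c x ∈ A := by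
  choose c hc hx using hA.cover
  refine ⟨c, ⟨fun x => hA.isHyperbolicChart _ (hc x), hx, fun x y hy => ?_⟩, hc⟩
  exact sign_eq_one_iff.2 (hA.det_pos _ (hc x) _ (hc y) y hy (hx y))

theorem IsOrientable.exists_choice (h : IsOrientable n X) :
    ∃ c : X → OpenPartialHomeomorph X (𝔼 n), IsOrientedChoice c :=
  let ⟨_, hA⟩ := h
  let ⟨c, hc, _⟩ := hA.exists_choice
  ⟨c, hc⟩

variable {c : X → OpenPartialHomeomorph X (𝔼 n)} {c' : Y → OpenPartialHomeomorph Y (𝔼 n)}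

/-- The chart `c y` varies with y; this lets one fixed chart replace it, so that continuity of the
Jacobian can be used. -/
theorem IsOrientedChoice.sign_eq_of_mem (hc : IsOrientedChoice c) (hf : IsLocalIsometry f)
    (he' : IsHyperbolicChart n e') {y : X} (hy : y ∈ (c x).source) (hfy : f y ∈ e'.source) :
    orientationSign f (c y) e' y = orientationSign f (c x) e' y := by
  have h := orientationSign_comp IsLocalIsometry.id hf (hc.chart x) (hc.chart y) he' hy
    (hc.mem_source y) hfy
  rw [hc.compatible x y hy, one_mul] at h
  exact h.symm

theorem IsOrientedChoice.sign_eq_of_mem_right (hc' : IsOrientedChoice c')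
    (hf : IsLocalIsometry f) (he : IsHyperbolicChart n e) (hx : x ∈ e.source)
    {y : Y} (hy : f x ∈ (c' y).source) :
    orientationSign f e (c' (f x)) x = orientationSign f e (c' y) x := by
  have h := orientationSign_comp hf IsLocalIsometry.id he (hc'.chart y) (hc'.chart (f x))
    hx hy (hc'.mem_source _)
  rw [hc'.compatible y _ hy, mul_one] at h
  exact h

theorem IsOrientedChoice.eventually_sign_eq (hc : IsOrientedChoice c) (hf : IsLocalIsometry f)
    (he' : IsHyperbolicChart n e') (hfx : f x ∈ e'.source) :
    ∀ᶠ y in 𝓝 x, orientationSign f (c y) e' y = orientationSign f (c x) e' x := by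
  filter_upwards [(c x).open_source.mem_nhds (hc.mem_source x),
    hf.continuous.continuousAt.preimage_mem_nhds (e'.open_source.mem_nhds hfx),
    eventually_orientationSign_eq hf (hc.chart x) he' (hc.mem_source x) hfx] with y hy hfy h
  rw [hc.sign_eq_of_mem hf he' hy hfy, h]

/-- The sign with which `f` transforms the orientations given by `c` and `c'`. -/
noncomputable def relativeSign (f : X → Y) (c : X → OpenPartialHomeomorph X (𝔼 n))
    (c' : Y → OpenPartialHomeomorph Y (𝔼 n)) (x : X) : SignType :=
  orientationSign f (c x) (c' (f x)) x

theorem relativeSign_ne_zero (hc : IsOrientedChoice c) (hc' : IsOrientedChoice c')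
    (hf : IsLocalIsometry f) (x : X) : relativeSign f c c' x ≠ 0 :=
  orientationSign_ne_zero hf (hc.chart x) (hc'.chart _) (hc.mem_source x) (hc'.mem_source _)

theorem eventually_relativeSign_eq (hc : IsOrientedChoice c) (hc' : IsOrientedChoice c')
    (hf : IsLocalIsometry f) (x : X) :
    ∀ᶠ y in 𝓝 x, relativeSign f c c' y = relativeSign f c c' x := by
  filter_upwards [hc.eventually_sign_eq hf (hc'.chart (f x)) (hc'.mem_source (f x)),
    hf.continuous.continuousAt.preimage_mem_nhds
      ((c' (f x)).open_source.mem_nhds (hc'.mem_source _))] with y hy hfy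
  rw [relativeSign, hc'.sign_eq_of_mem_right hf (hc.chart y) (hc.mem_source y) hfy, hy]
  rfl

theorem relativeSign_const [PreconnectedSpace X] (hc : IsOrientedChoice c)
    (hc' : IsOrientedChoice c') (hf : IsLocalIsometry f) (x y : X) :
    relativeSign f c c' x = relativeSign f c c' y :=
  (IsLocallyConstant.iff_eventually_eq _).2 (eventually_relativeSign_eq hc hc' hf)
    |>.apply_eq_of_preconnectedSpace x y

/-- An orientation pulls back along a local isometry. -/
theorem IsOrientable.of_isLocalIsometry (h : IsOrientable n Y) (hf : IsLocalIsometry f) :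
    IsOrientable n X := by
  obtain ⟨c', hc'⟩ := h.exists_choice
  choose c hc hx hsub hcf using fun x =>
    hf.exists_pullback_chart (x := x) (hc'.chart (f x)) (hc'.mem_source (f x))
  refine isOrientable_of_charts c hc hx fun x => ?_
  filter_upwards [(c x).open_source.mem_nhds (hx x)] with y hy
  have h1 : orientationSign f (c x) (c' (f x)) y = 1 := orientationSign_pullback hy (hcf x)
  have h2 : orientationSign f (c y) (c' (f y)) y = 1 := orientationSign_pullback (hx y) (hcf y)
  rw [hc'.sign_eq_of_mem_right hf (hc y) (hx y) (hsub x y hy)] at h2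
  have h3 := orientationSign_comp IsLocalIsometry.id hf (hc x) (hc y) (hc'.chart (f x)) hy (hx y)
    (hsub x y hy)
  rw [h1, h2, mul_one] at h3
  exact h3.symm

end Charts

/-! ### Totally geodesic hypersurfaces in adapted charts. -/

section Hypersurfaces

variable {n : ℕ} {X Y : Type*} [MetricSpace X] [MetricSpace Y]

local notation "𝔼" n => EuclideanSpace ℝ (Fin n)

/-- A chart in which `S` is the hyperplane on which the last coordinate vanishes. -/
structure IsAdaptedChart (n : ℕ) (S : Set X) (e : OpenPartialHomeomorph X (𝔼 (n + 1))) : Prop where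
  chart : IsHyperbolicChart (n + 1) e
  mem_iff : ∀ y ∈ e.source, y ∈ S ↔ e y (Fin.last n) = 0

theorem IsTotallyGeodesicHypersurface.exists_chart {S : Set X}
    (hS : IsTotallyGeodesicHypersurface n S) {x : X} (hx : x ∈ S) :
    ∃ e, IsAdaptedChart n S e ∧ x ∈ e.source :=
  let ⟨e, h1, h2, h3⟩ := hS x hx
  ⟨e, ⟨h1, h3⟩, h2⟩

theorem IsAdaptedChart.reflectChart {S : Set X} {e : OpenPartialHomeomorph X (𝔼 (n + 1))}
    (he : IsAdaptedChart n S e) (i : Fin (n + 1)) : IsAdaptedChart n S (reflectChart i e) where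
  chart := he.chart.reflectChart i
  mem_iff y hy := by
    rw [he.mem_iff y hy, reflectChart_apply]
    rcases eq_or_ne (Fin.last n) i with h | h
    · rw [← h, coordReflection_apply_self, neg_eq_zero]
    · rw [coordReflection_apply_of_ne h]

theorem IsAdaptedChart.exists_pullback {S : Set Y} {e' : OpenPartialHomeomorph Y (𝔼 (n + 1))}
    (he' : IsAdaptedChart n S e') {f : X → Y} (hf : IsLocalIsometry f) {x : X}
    (hx : f x ∈ e'.source) : ∃ e, IsAdaptedChart n (f ⁻¹' S) e ∧ x ∈ e.source ∧
      (∀ y ∈ e.source, f y ∈ e'.source) ∧ ∀ y, e y = e' (f y) := by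
  obtain ⟨e, he, hxe, hsub, h⟩ := hf.exists_pullback_chart he'.chart hx
  refine ⟨e, ⟨he, fun y hy => ?_⟩, hxe, hsub, h⟩
  rw [h, ← he'.mem_iff _ (hsub y hy)]
  rfl

theorem IsTotallyGeodesicHypersurface.preimage {S : Set Y}
    (hS : IsTotallyGeodesicHypersurface n S) {f : X → Y} (hf : IsLocalIsometry f) :
    IsTotallyGeodesicHypersurface n (f ⁻¹' S) := fun x hx => by
  obtain ⟨e', he', hx'⟩ := hS.exists_chart hx
  obtain ⟨e, he, hxe, -, -⟩ := he'.exists_pullback hf hx'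
  exact ⟨e, he.chart, hxe, he.mem_iff⟩

/-- A local isometry that fixes a totally geodesic hypersurface pointwise is locally the identity
or the reflection in that hypersurface. -/
theorem IsAdaptedChart.eq_or_eq_reflection {S : Set X} {e : OpenPartialHomeomorph X (𝔼 (n + 1))}
    (he : IsAdaptedChart n S e) {x : X} (hx : x ∈ e.source) (hxS : x ∈ S) {ρ : X → X}
    (hρ : IsLocalIsometry ρ) (hfix : ∀ y ∈ S, ρ y = y) :
    (∀ᶠ y in 𝓝 x, ρ y = y) ∨ ∀ᶠ y in 𝓝 x, e (ρ y) = coordReflection (Fin.last n) (e y) := by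
  have hρx : ρ x ∈ e.source := by rwa [hfix x hxS]
  have h := hρ.hypIsoAt he.chart he.chart hx hρx
  have hf : ∀ᶠ v in 𝓝 (e x), v (Fin.last n) = 0 → e (ρ (e.symm v)) = v := by
    filter_upwards [e.open_target.mem_nhds (e.map_source hx)] with v hv hv0
    rw [hfix, e.right_inv hv]
    rw [he.mem_iff _ (e.map_target hv), e.right_inv hv, hv0]
  rcases h.eq_or_eq_coordReflection ((he.mem_iff x hx).1 hxS) hf with h1 | h1
  · left
    filter_upwards [(e.continuousAt hx).eventually h1, e.open_source.mem_nhds hx,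
      hρ.continuous.continuousAt.preimage_mem_nhds (e.open_source.mem_nhds hρx)] with y hy hye hρy
    rw [e.left_inv hye] at hy
    exact e.injOn hρy hye hy
  · right
    filter_upwards [(e.continuousAt hx).eventually h1, e.open_source.mem_nhds hx] with y hy hye
    rwa [e.left_inv hye] at hy

end Hypersurfaces

/-! ### Charts and orientation signs on a hypersurface. -/

section InducedCharts

variable {n : ℕ} {X : Type*} [MetricSpace X]

local notation "𝔼" n => EuclideanSpace ℝ (Fin n)

open Classical in
/-- The chart of a totally geodesic hypersurface which is induced by an adapted chart. -/
noncomputable def inducedChart {S : Set X} {e : OpenPartialHomeomorph X (𝔼 (n + 1))}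
    (he : IsAdaptedChart n S e) (s : S) : OpenPartialHomeomorph S (𝔼 n) where
  toFun y := hyperplaneProj n (e y)
  -- The point s is a default value outside the target; on the target the inverse of e lands in S.
  invFun v := if h : e.symm (hyperplaneIncl n v) ∈ S then ⟨_, h⟩ else s
  source := Subtype.val ⁻¹' e.source
  target := hyperplaneIncl n ⁻¹' e.target
  map_source' y hy := by
    rw [Set.mem_preimage, hyperplaneIncl_proj ((he.mem_iff _ hy).1 y.2)]
    exact e.map_source hy
  map_target' v hv := by
    have h : e.symm (hyperplaneIncl n v) ∈ S := by
      rw [he.mem_iff _ (e.map_target hv), e.right_inv hv, hyperplaneIncl_last]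
    rw [dif_pos h]
    exact e.map_target hv
  left_inv' y hy := by
    have h1 : e.symm (hyperplaneIncl n (hyperplaneProj n (e y))) = y := by
      rw [hyperplaneIncl_proj ((he.mem_iff _ hy).1 y.2), e.left_inv hy]
    have h : e.symm (hyperplaneIncl n (hyperplaneProj n (e y))) ∈ S := by
      rw [h1]; exact y.2
    rw [dif_pos h]
    exact Subtype.ext h1
  right_inv' v hv := by
    have h : e.symm (hyperplaneIncl n v) ∈ S := by
      rw [he.mem_iff _ (e.map_target hv), e.right_inv hv, hyperplaneIncl_last]
    rw [dif_pos h]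
    simp [e.right_inv hv]
  open_source := e.open_source.preimage continuous_subtype_val
  open_target := e.open_target.preimage (hyperplaneIncl n).continuous
  continuousOn_toFun := (hyperplaneProj n).continuous.comp_continuousOn
    (e.continuousOn.comp continuous_subtype_val.continuousOn fun _ hy => hy)
  continuousOn_invFun := by
    rw [Topology.IsInducing.subtypeVal.continuousOn_iff]
    refine (e.continuousOn_symm.comp (hyperplaneIncl n).continuous.continuousOn
      fun _ hv => hv).congr fun v hv => ?_
    have h : e.symm (hyperplaneIncl n v) ∈ S := by
      rw [he.mem_iff _ (e.map_target hv), e.right_inv hv, hyperplaneIncl_last]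
    simp only [Function.comp_apply, dif_pos h]

variable {S : Set X} {e e' : OpenPartialHomeomorph X (𝔼 (n + 1))} (he : IsAdaptedChart n S e)
  (he' : IsAdaptedChart n S e') {s : S}

theorem inducedChart_apply (s y : S) : inducedChart he s y = hyperplaneProj n (e y) := rfl

open Classical in
theorem inducedChart_symm_apply (s : S) {v : 𝔼 n} (hv : hyperplaneIncl n v ∈ e.target) :
    ((inducedChart he s).symm v : X) = e.symm (hyperplaneIncl n v) := by
  have h : e.symm (hyperplaneIncl n v) ∈ S := by
    rw [he.mem_iff _ (e.map_target hv), e.right_inv hv, hyperplaneIncl_last]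
  change ((if h : e.symm (hyperplaneIncl n v) ∈ S then ⟨_, h⟩ else s : S) : X) = _
  rw [dif_pos h]

theorem isHyperbolicChart_inducedChart (s : S) : IsHyperbolicChart n (inducedChart he s) where
  target_subset v hv := by
    have := he.chart.target_subset hv
    simpa using this
  dist_eq y hy z hz := by
    rw [inducedChart_apply, inducedChart_apply, ← hypDist_hyperplaneIncl,
      hyperplaneIncl_proj ((he.mem_iff _ hy).1 y.2), hyperplaneIncl_proj ((he.mem_iff _ hz).1 z.2),
      ← he.chart.dist_eq _ hy _ hz]
    rfl

/-- The determinant of a change of adapted charts, compared with that of the change of induced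
charts. -/
theorem exists_det_eq_mul_det_inducedChart (t t' : S) (hs : (s : X) ∈ e.source)
    (hs' : (s : X) ∈ e'.source) :
    ∃ a : ℝ, (fderiv ℝ (fun v => e' (e.symm v)) (e s)).det =
      a * (fderiv ℝ (fun v => inducedChart he' t' ((inducedChart he t).symm v))
        (inducedChart he t s)).det ∧
      HasDerivAt (fun r : ℝ => e' (e.symm (e s + r • EuclideanSpace.single (Fin.last n) 1))
        (Fin.last n)) a 0 ∧ e' (e.symm (e s)) (Fin.last n) = 0 := by
  set f := fun v => e' (e.symm v) with hf
  have hiso : HypIsoAt f (e s) := IsLocalIsometry.id.hypIsoAt he.chart he'.chart hs hs'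
  have hincl : hyperplaneIncl n (inducedChart he t s) = e s :=
    hyperplaneIncl_proj ((he.mem_iff _ hs).1 s.2)
  have hdf : HasFDerivAt f (fderiv ℝ f (e s)) (e s) := hiso.differentiableAt.hasFDerivAt
  set D := fderiv ℝ f (e s) with hD
  have hfι : HasFDerivAt (fun v => f (hyperplaneIncl n v)) (D.comp (hyperplaneIncl n))
      (inducedChart he t s) := by
    refine HasFDerivAt.comp (g := f) _ ?_ (hyperplaneIncl n).hasFDerivAt
    rwa [hincl]
  have hnhds : ∀ᶠ v in 𝓝 (inducedChart he t s), hyperplaneIncl n v ∈ e.target ∧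
      e.symm (hyperplaneIncl n v) ∈ e'.source := by
    have h1 : e.target ∩ e.symm ⁻¹' e'.source ∈ 𝓝 (hyperplaneIncl n (inducedChart he t s)) := by
      rw [hincl]
      refine (e.isOpen_inter_preimage_symm e'.open_source).mem_nhds ⟨e.map_source hs, ?_⟩
      rwa [Set.mem_preimage, e.left_inv hs]
    exact (hyperplaneIncl n).continuous.continuousAt.preimage_mem_nhds h1
  have hmemS : ∀ v, hyperplaneIncl n v ∈ e.target → e.symm (hyperplaneIncl n v) ∈ S := by
    intro v hv
    rw [he.mem_iff _ (e.map_target hv), e.right_inv hv, hyperplaneIncl_last]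
  -- The coordinate change maps the hyperplane to itself, so its derivative does too.
  have hlast : ∀ v, D (hyperplaneIncl n v) (Fin.last n) = 0 := by
    intro v
    have h1 : HasFDerivAt (fun v => f (hyperplaneIncl n v) (Fin.last n))
        ((EuclideanSpace.proj (𝕜 := ℝ) (Fin.last n)).comp (D.comp (hyperplaneIncl n)))
        (inducedChart he t s) :=
      (EuclideanSpace.proj (𝕜 := ℝ) (Fin.last n)).hasFDerivAt.comp _ hfι
    have h2 : (fun v => f (hyperplaneIncl n v) (Fin.last n)) =ᶠ[𝓝 (inducedChart he t s)]
        fun _ => (0 : ℝ) := by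
      filter_upwards [hnhds] with v hv
      exact (he'.mem_iff _ hv.2).1 (hmemS v hv.1)
    have h3 := (h1.congr_of_eventuallyEq h2.symm).unique (hasFDerivAt_const (0 : ℝ) _)
    exact DFunLike.congr_fun h3 v
  -- The factor a is the normal entry of the block triangular derivative, that is, the derivative of
  -- the last coordinate in the normal direction.
  refine ⟨D (EuclideanSpace.single (Fin.last n) 1) (Fin.last n), ?_, ?_, ?_⟩
  · rw [det_eq_of_preserves_hyperplane D hlast]
    congr 2
    have h1 : HasFDerivAt (fun v => hyperplaneProj n (f (hyperplaneIncl n v)))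
        ((hyperplaneProj n).comp (D.comp (hyperplaneIncl n))) (inducedChart he t s) :=
      (hyperplaneProj n).hasFDerivAt.comp _ hfι
    refine (h1.congr_of_eventuallyEq ?_).fderiv.symm
    filter_upwards [hnhds] with v hv
    rw [inducedChart_apply, inducedChart_symm_apply he t hv.1]
  · have h1 : HasDerivAt (fun r : ℝ => e s + r • EuclideanSpace.single (Fin.last n) (1 : ℝ))
        (EuclideanSpace.single (Fin.last n) 1) 0 := by
      simpa using ((hasDerivAt_id (0 : ℝ)).smul_const
        (EuclideanSpace.single (Fin.last n) (1 : ℝ))).const_add (e s)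
    have h2 := HasFDerivAt.comp_hasDerivAt (l := f) (l' := D) (0 : ℝ) (by simpa using hdf) h1
    exact ((EuclideanSpace.proj (𝕜 := ℝ) (Fin.last n)).hasFDerivAt.comp_hasDerivAt (0 : ℝ) h2)
  · rw [e.left_inv hs]
    exact (he'.mem_iff _ hs').1 s.2

/-- Moving from s in the positive normal direction of the chart stays on the positive side, which
fixes the sign of one-sided normal difference quotients. -/
theorem eventually_mem_positive_side (hs : (s : X) ∈ e.source) {P : X → Prop}
    (h : ∀ᶠ z in 𝓝 (s : X), 0 < e z (Fin.last n) → P z) (he : IsAdaptedChart n S e) :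
    ∀ᶠ r : ℝ in 𝓝[>] 0, P (e.symm (e s + r • EuclideanSpace.single (Fin.last n) 1)) := by
  have hc : Tendsto (fun r : ℝ => e s + r • EuclideanSpace.single (Fin.last n) (1 : ℝ)) (𝓝[>] 0)
      (𝓝 (e s)) := by
    have : Continuous fun r : ℝ => e s + r • EuclideanSpace.single (Fin.last n) (1 : ℝ) := by
      fun_prop
    simpa using (this.tendsto 0).mono_left nhdsWithin_le_nhds
  have h1 : Tendsto e.symm (𝓝 (e s)) (𝓝 (s : X)) := by
    have := e.continuousAt_symm (e.map_source hs)
    rwa [ContinuousAt, e.left_inv hs] at this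
  filter_upwards [hc.eventually (h1.eventually h), hc.eventually (e.open_target.mem_nhds
    (e.map_source hs)), self_mem_nhdsWithin] with r hr ht hr0
  apply hr
  rw [e.right_inv ht]
  have : e (s : X) (Fin.last n) = 0 := (he.mem_iff _ hs).1 s.2
  simpa [this] using hr0

/-- The normal factor a is a limit of positive difference quotients, and it is nonzero because the
full determinant is. So it does not affect the sign. -/
theorem orientationSign_inducedChart (t t' : S) (hs : (s : X) ∈ e.source)
    (hs' : (s : X) ∈ e'.source)
    (h : ∀ᶠ z in 𝓝 (s : X), 0 < e z (Fin.last n) → 0 < e' z (Fin.last n)) :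
    orientationSign (fun y : S => y) (inducedChart he t) (inducedChart he' t') s =
      orientationSign (fun y : X => y) e e' (s : X) := by
  obtain ⟨a, hdet, ha, h0⟩ := exists_det_eq_mul_det_inducedChart he he' t t' hs hs'
  have ha0 : 0 ≤ a := by
    refine ge_of_tendsto ha.tendsto_slope_zero_right ?_
    filter_upwards [eventually_mem_positive_side hs h he, self_mem_nhdsWithin] with r hr hr0
    simp only [zero_add, zero_smul, add_zero, h0, sub_zero, smul_eq_mul]
    exact (mul_pos (inv_pos.2 hr0) hr).le
  have hne := (IsLocalIsometry.id.hypIsoAt he.chart he'.chart hs hs').det_ne_zero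
  rw [hdet] at hne
  have ha1 : 0 < a := ha0.lt_of_ne' (left_ne_zero_of_mul hne)
  rw [orientationSign, orientationSign, hdet, sign_mul, sign_pos ha1, one_mul]

/-- Here the sides are exchanged, so the normal factor is negative. -/
theorem orientationSign_inducedChart_neg (t t' : S) (hs : (s : X) ∈ e.source)
    (hs' : (s : X) ∈ e'.source)
    (h : ∀ᶠ z in 𝓝 (s : X), 0 < e z (Fin.last n) → e' z (Fin.last n) < 0) :
    orientationSign (fun y : S => y) (inducedChart he t) (inducedChart he' t') s =
      -orientationSign (fun y : X => y) e e' (s : X) := by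
  obtain ⟨a, hdet, ha, h0⟩ := exists_det_eq_mul_det_inducedChart he he' t t' hs hs'
  have ha0 : a ≤ 0 := by
    refine le_of_tendsto ha.tendsto_slope_zero_right ?_
    filter_upwards [eventually_mem_positive_side hs h he, self_mem_nhdsWithin] with r hr hr0
    simp only [zero_add, zero_smul, add_zero, h0, sub_zero, smul_eq_mul]
    exact (mul_neg_of_pos_of_neg (inv_pos.2 hr0) hr).le
  have hne := (IsLocalIsometry.id.hypIsoAt he.chart he'.chart hs hs').det_ne_zero
  rw [hdet] at hne
  have ha1 : a < 0 := ha0.lt_of_ne (left_ne_zero_of_mul hne)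
  rw [orientationSign, orientationSign, hdet, sign_mul, sign_neg ha1, neg_one_mul, neg_neg]

end InducedCharts

/-! ### Local isometries and lengths of paths. -/

section Length

variable {X Y : Type*} [MetricSpace X] [MetricSpace Y]

/-- By compactness the path is cut into pieces, each inside an open set on which f preserves
distances; the triangle inequality is applied to the images of the cut points. -/
theorem IsLocalIsometry.edist_le_eVariationOn {f : X → Y} (hf : IsLocalIsometry f) {x y : X}
    (γ : Path x y) : edist (f x) (f y) ≤ eVariationOn γ Set.univ := by
  choose U hU hxU hd using hf.exists_isOpen
  obtain ⟨t, ht0, hmono, ⟨n, hn⟩, hsub⟩ := exists_monotone_Icc_subset_open_cover_unitInterval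
    (c := fun z => γ ⁻¹' U z) (fun z => (hU z).preimage γ.continuous)
    (fun s _ => Set.mem_iUnion.2 ⟨γ s, hxU _⟩)
  calc edist (f x) (f y) = edist (f (γ (t 0))) (f (γ (t n))) := by rw [ht0, hn n le_rfl]; simp
    _ ≤ ∑ i ∈ Finset.range n, edist (f (γ (t i))) (f (γ (t (i + 1)))) :=
      edist_le_range_sum_edist (fun i => f (γ (t i))) n
    _ = ∑ i ∈ Finset.range n, edist (γ (t (i + 1))) (γ (t i)) := by
      refine Finset.sum_congr rfl fun i _ => ?_
      obtain ⟨z, hz⟩ := hsub i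
      rw [edist_comm, edist_dist, edist_dist,
        hd z _ (hz ⟨hmono (Nat.le_succ i), le_rfl⟩) _ (hz ⟨le_rfl, hmono (Nat.le_succ i)⟩)]
    _ ≤ _ := eVariationOn.sum_le hmono fun _ => Set.mem_univ _

theorem IsLocalIsometry.dist_le {n : ℕ} {f : X → Y} (hX : IsHyperbolicManifold n X)
    (hf : IsLocalIsometry f) (x y : X) : dist (f x) (f y) ≤ dist x y := by
  refine le_of_forall_pos_le_add fun ε hε => ?_
  obtain ⟨γ, hγ⟩ := hX.length_metric x y ε hε
  have h := (hf.edist_le_eVariationOn γ).trans hγ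
  rw [edist_dist] at h
  exact (ENNReal.ofReal_le_ofReal_iff (by positivity)).1 h

/-- An involutive local isometry of a hyperbolic manifold is an isometry. -/
theorem IsLocalIsometry.exists_isometryEquiv {n : ℕ} {f : X → X} (hX : IsHyperbolicManifold n X)
    (hf : IsLocalIsometry f) (hinv : Function.Involutive f) : ∃ θ : X ≃ᵢ X, ⇑θ = f := by
  refine ⟨⟨hinv.toPerm f, Isometry.of_dist_eq fun x y => ?_⟩, rfl⟩
  refine (hf.dist_le hX x y).antisymm ?_
  have := hf.dist_le hX (f x) (f y)
  rwa [hinv, hinv] at this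

end Length

/-! ### The exchange of the sheets of a double cover. -/

section SheetSwap

variable {M N : Type*} {p : M → N} {τ : M → M}

/-- `τ` interchanges the two points of each fibre of `p`. -/
structure IsSheetSwap (p : M → N) (τ : M → M) : Prop where
  ne : ∀ x, τ x ≠ x
  map_eq : ∀ x, p (τ x) = p x
  eq_or_eq : ∀ x y, p y = p x → y = x ∨ y = τ x

theorem exists_isSheetSwap (h : ∀ x : N, (p ⁻¹' {x}).ncard = 2) : ∃ τ, IsSheetSwap p τ := by
  have h1 : ∀ x : M, ∃ z, z ≠ x ∧ p z = p x ∧ ∀ y, p y = p x → y = x ∨ y = z := by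
    intro x
    obtain ⟨a, b, hab, hset⟩ := Set.ncard_eq_two.1 (h (p x))
    have hmem : ∀ y, p y = p x ↔ y = a ∨ y = b := fun y => by
      have : y ∈ p ⁻¹' {p x} ↔ y ∈ ({a, b} : Set M) := by rw [hset]
      simpa using this
    rcases (hmem x).1 rfl with rfl | rfl
    · exact ⟨b, hab.symm, (hmem b).2 (Or.inr rfl), fun y hy => (hmem y).1 hy⟩
    · exact ⟨a, hab, (hmem a).2 (Or.inl rfl), fun y hy => ((hmem y).1 hy).symm⟩
  choose τ h1 h2 h3 using h1
  exact ⟨τ, h1, h2, h3⟩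

theorem surjective_of_two_sheeted (h : ∀ x : N, (p ⁻¹' {x}).ncard = 2) :
    Function.Surjective p := fun x => by
  have : (p ⁻¹' {x}).ncard ≠ 0 := by rw [h x]; decide
  exact Set.nonempty_of_ncard_ne_zero this

theorem IsSheetSwap.involutive (hτ : IsSheetSwap p τ) : Function.Involutive τ := fun x =>
  ((hτ.eq_or_eq (τ x) x (hτ.map_eq x).symm).resolve_left (hτ.ne x).symm).symm

end SheetSwap

/-! ### The sheet swap and orientations. -/

section DoubleCover

variable {n : ℕ} {M N : Type*} [MetricSpace M] [MetricSpace N] {p : M → N} {τ : M → M}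

local notation "𝔼" n => EuclideanSpace ℝ (Fin n)

theorem IsOrientableDoubleCover.isLocalIsometry (hp : IsOrientableDoubleCover p) :
    IsLocalIsometry p where
  isOpenMap := hp.covering.isOpenMap
  dist_eq x := by
    obtain ⟨r, hr, h⟩ := hp.local_isometry x
    exact ⟨_, Metric.ball_mem_nhds x hr, h⟩

namespace IsSheetSwap

/-- Since τ lifts p along p, only continuity is at stake. A point close to τ x lying over p y, with
y close to x, differs from y, so it must be τ y. -/
theorem isLocalIsometry (hτ : IsSheetSwap p τ) (hp : IsLocalIsometry p) : IsLocalIsometry τ := by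
  refine hp.of_comp ?_ (by
    have : p ∘ τ = p := funext hτ.map_eq
    rwa [this])
  rw [continuous_iff_continuousAt]
  intro x
  obtain ⟨P, Q, hP, hQ, hxP, hxQ, hPQ⟩ := t2_separation (hτ.ne x).symm
  intro W hW
  rw [mem_map]
  have h1 : p '' (W ∩ Q) ∈ 𝓝 (p x) := by
    rw [← hτ.map_eq x]
    exact hp.isOpenMap.image_mem_nhds (inter_mem hW (hQ.mem_nhds hxQ))
  filter_upwards [hP.mem_nhds hxP, hp.continuous.continuousAt.preimage_mem_nhds h1] with y hyP hy
  obtain ⟨w, hw, hwy⟩ := hy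
  have hne : w ≠ y := fun h => Set.disjoint_left.1 hPQ hyP (h ▸ hw.2)
  rw [Set.mem_preimage, ← (hτ.eq_or_eq y w hwy).resolve_left hne]
  exact hw.1

end IsSheetSwap

theorem IsOrientedChoice.exists_chart_sign_eq_one {c : M → OpenPartialHomeomorph M (𝔼 n)}
    (hc : IsOrientedChoice c) (hp : IsLocalIsometry p) (i : Fin n) {x : M}
    {e : OpenPartialHomeomorph N (𝔼 n)} (he : IsHyperbolicChart n e) (hx : p x ∈ e.source) :
    ∃ e' : OpenPartialHomeomorph N (𝔼 n), IsHyperbolicChart n e' ∧ p x ∈ e'.source ∧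
      orientationSign p (c x) e' x = 1 := by
  have h0 := orientationSign_ne_zero hp (hc.chart x) he (hc.mem_source x) hx
  rcases h : orientationSign p (c x) e x with _ | _ | _
  · exact absurd h h0
  · refine ⟨reflectChart i e, he.reflectChart i, hx, ?_⟩
    rw [orientationSign_reflectChart, h]
    rfl
  · exact ⟨e, he, hx, h⟩

/-- The sign of the covering at the other point of a fibre. -/
theorem IsSheetSwap.orientationSign_swap {c : M → OpenPartialHomeomorph M (𝔼 n)}
    (hτ : IsSheetSwap p τ) (hp : IsLocalIsometry p) (hc : IsOrientedChoice c) {x : M}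
    {e : OpenPartialHomeomorph N (𝔼 n)} (he : IsHyperbolicChart n e) (hx : p x ∈ e.source) :
    orientationSign p (c x) e x = relativeSign τ c c x * orientationSign p (c (τ x)) e (τ x) := by
  have h := orientationSign_comp (hτ.isLocalIsometry hp) hp (hc.chart x) (hc.chart (τ x)) he
    (hc.mem_source x) (hc.mem_source (τ x)) (by rwa [hτ.map_eq])
  simp only [hτ.map_eq] at h
  exact h

theorem IsLocalIsometry.eventually_exists {X Y : Type*} [MetricSpace X] [MetricSpace Y]
    {f : X → Y} (hf : IsLocalIsometry f) {x : X}
    {P : X → Prop} (h : ∀ᶠ y in 𝓝 x, P y) : ∀ᶠ z in 𝓝 (f x), ∃ y, f y = z ∧ P y := by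
  filter_upwards [hf.isOpenMap.image_mem_nhds h] with z hz
  obtain ⟨y, hy, rfl⟩ := hz
  exact ⟨y, rfl, hy⟩

/-- If the sheet swap preserves orientation, then the orientation descends. -/
theorem IsSheetSwap.isOrientable (hτ : IsSheetSwap p τ) (hp : IsLocalIsometry p)
    (hsurj : Function.Surjective p) (i : Fin n)
    (hchart : ∀ x : N, ∃ e : OpenPartialHomeomorph N (𝔼 n), IsHyperbolicChart n e ∧ x ∈ e.source)
    {c : M → OpenPartialHomeomorph M (𝔼 n)} (hc : IsOrientedChoice c)
    (h : ∀ x, relativeSign τ c c x = 1) : IsOrientable n N := by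
  have hex : ∀ y : N, ∃ m, p m = y ∧ ∃ e : OpenPartialHomeomorph N (𝔼 n),
      IsHyperbolicChart n e ∧ y ∈ e.source ∧ orientationSign p (c m) e m = 1 := by
    intro y
    obtain ⟨m, rfl⟩ := hsurj y
    obtain ⟨e, he, hy⟩ := hchart (p m)
    exact ⟨m, rfl, hc.exists_chart_sign_eq_one hp i he hy⟩
  choose m hm e he hy hs using hex
  refine isOrientable_of_charts e he hy fun y => ?_
  have hev : ∀ᶠ x in 𝓝 (m y), orientationSign p (c x) (e y) x = 1 ∧ p x ∈ (e y).source := by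
    have hsrc : p (m y) ∈ (e y).source := by rw [hm]; exact hy y
    filter_upwards [hc.eventually_sign_eq hp (he y) hsrc,
      hp.continuous.continuousAt.preimage_mem_nhds ((e y).open_source.mem_nhds hsrc)] with x hx hx'
    exact ⟨hx.trans (hs y), hx'⟩
  have := hp.eventually_exists hev
  rw [hm] at this
  filter_upwards [this] with z hz
  obtain ⟨x, rfl, hx1, hx2⟩ := hz
  have hx3 : orientationSign p (c x) (e (p x)) x = 1 := by
    have h1 := hs (p x)
    -- The lift chosen for p x may be τ x instead of x; the sign is the same because τ preserves
    -- orientation.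
    rcases hτ.eq_or_eq x _ (hm (p x)) with h2 | h2
    · rwa [h2] at h1
    · rw [h2] at h1
      rw [hτ.orientationSign_swap hp hc (he _) (hy _), h, h1, one_mul]
  have h4 := orientationSign_comp hp IsLocalIsometry.id (hc.chart x) (he y) (he (p x))
    (hc.mem_source x) hx2 (hy _)
  rw [hx1, hx3, one_mul] at h4
  exact h4.symm

/-- The sign is constant on the connected M, and if it were 1 the orientation would descend to N. -/
theorem IsSheetSwap.relativeSign_eq_neg_one (hτ : IsSheetSwap p τ) (hp : IsLocalIsometry p)
    [PreconnectedSpace M] (hsurj : Function.Surjective p) (i : Fin n)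
    (hN : IsHyperbolicManifold n N) (hno : ¬ IsOrientable n N)
    {c : M → OpenPartialHomeomorph M (𝔼 n)} (hc : IsOrientedChoice c) (x : M) :
    relativeSign τ c c x = -1 := by
  have hconst := relativeSign_const hc hc (hτ.isLocalIsometry hp)
  rcases h : relativeSign τ c c x with _ | _ | _
  · exact absurd h (relativeSign_ne_zero hc hc (hτ.isLocalIsometry hp) x)
  · rfl
  · exact absurd (hτ.isOrientable hp hsurj i hN.locally_hyperbolic hc
      fun y => (hconst y x).trans h) hno

end DoubleCover

/-! ### Finiteness of the volume of the double cover. -/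

section Volume

open MeasureTheory

/-- A finite value forces, for each ε, a countable cover by sets of diameter at most ε; one point
from each set gives a countable ε-net. -/
theorem secondCountableTopology_of_hausdorffMeasure_lt_top {X : Type*} [MetricSpace X]
    [MeasurableSpace X] [BorelSpace X] {d : ℝ}
    (h : Measure.hausdorffMeasure d (Set.univ : Set X) < ⊤) : SecondCountableTopology X := by
  refine Metric.secondCountable_of_almost_dense_set fun ε hε => ?_
  rw [Measure.hausdorffMeasure_apply] at h
  have h1 := (le_iSup₂ (f := fun (r : ENNReal) (_ : 0 < r) =>
    ⨅ (t : ℕ → Set X) (_ : Set.univ ⊆ ⋃ n, t n) (_ : ∀ n, Metric.ediam (t n) ≤ r),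
      ∑' n, ⨆ _ : (t n).Nonempty, Metric.ediam (t n) ^ d) (ENNReal.ofReal ε)
      (ENNReal.ofReal_pos.2 hε)).trans_lt h
  simp only [iInf_lt_iff] at h1
  obtain ⟨t, ht, hd, -⟩ := h1
  refine ⟨{x | ∃ n, ∃ h : (t n).Nonempty, x = h.some}, ?_, fun x => ?_⟩
  · refine (Set.countable_iUnion fun n : ℕ =>
      (Set.Subsingleton.countable (s := {x | ∃ h : (t n).Nonempty, x = h.some}) ?_)).mono ?_
    · rintro x ⟨h, rfl⟩ y ⟨h', rfl⟩
      rfl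
    · rintro x ⟨n, hn⟩
      exact Set.mem_iUnion.2 ⟨n, hn⟩
  · obtain ⟨n, hn⟩ := Set.mem_iUnion.1 (ht (Set.mem_univ x))
    refine ⟨_, ⟨n, ⟨x, hn⟩, rfl⟩, ?_⟩
    have h2 := (Metric.edist_le_ediam_of_mem hn (Set.Nonempty.some_mem ⟨x, hn⟩)).trans (hd n)
    rw [edist_dist] at h2
    exact (ENNReal.ofReal_le_ofReal_iff hε.le).1 h2

variable {M N : Type*} [MetricSpace M] [MetricSpace N] {p : M → N} {τ : M → M}

/-- The sections are local inverses of p with values near m and near τ m. They preserve distances,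
and their values are kept in disjoint open sets, so together they exhaust each fibre. -/
theorem IsSheetSwap.exists_sections (hτ : IsSheetSwap p τ) (hp : IsLocalIsometry p)
    (hsurj : Function.Surjective p) (y : N) : ∃ V : Set N, IsOpen V ∧ y ∈ V ∧ ∃ q q' : N → M,
      LipschitzOnWith 1 q V ∧ LipschitzOnWith 1 q' V ∧
      ∀ x, p x ∈ V → x = q (p x) ∨ x = q' (p x) := by
  obtain ⟨m, rfl⟩ := hsurj y
  obtain ⟨P, Q, hP, hQ, hmP, hmQ, hPQ⟩ := t2_separation (hτ.ne m).symm
  have key : ∀ (x : M) (P : Set M), IsOpen P → x ∈ P → ∃ φ : OpenPartialHomeomorph M N,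
      p x ∈ φ.target ∧ φ.source ⊆ P ∧ LipschitzOnWith 1 φ.symm φ.target ∧
      ∀ z ∈ φ.target, p (φ.symm z) = z := by
    intro x P hP hx
    obtain ⟨φ, hxφ, hφ, hd⟩ := hp.exists_openPartialHomeomorph x
    have hsub : (φ.restrOpen P hP).target ⊆ φ.target := fun z hz => hz.1
    refine ⟨φ.restrOpen P hP, ?_, ?_, ?_, fun z hz => ?_⟩
    · rw [← hφ]
      exact (φ.restrOpen P hP).map_source ⟨hxφ, hx⟩
    · exact fun z hz => hz.2
    · refine LipschitzOnWith.of_dist_le_mul fun z hz w hw => ?_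
      have h1 := hd _ (φ.map_target (hsub hz)) _ (φ.map_target (hsub hw))
      rw [← hφ, ← hφ, φ.right_inv (hsub hz), φ.right_inv (hsub hw)] at h1
      rw [NNReal.coe_one, one_mul, h1]
      rfl
    · rw [← hφ]
      exact φ.right_inv (hsub hz)
  obtain ⟨φ, h1, h2, h3, h4⟩ := key m P hP hmP
  obtain ⟨ψ, h1', h2', h3', h4'⟩ := key (τ m) Q hQ hmQ
  rw [hτ.map_eq] at h1'
  refine ⟨φ.target ∩ ψ.target, φ.open_target.inter ψ.open_target, ⟨h1, h1'⟩, φ.symm, ψ.symm,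
    h3.mono Set.inter_subset_left, h3'.mono Set.inter_subset_right, fun x hx => ?_⟩
  have hne : φ.symm (p x) ≠ ψ.symm (p x) := fun h =>
    Set.disjoint_left.1 hPQ (h2 (φ.map_target hx.1)) (h ▸ h2' (ψ.map_target hx.2))
  rcases hτ.eq_or_eq x _ (h4 _ hx.1) with h | h
  · exact Or.inl h.symm
  · rcases hτ.eq_or_eq x _ (h4' _ hx.2) with h' | h'
    · exact Or.inr h'.symm
    · exact absurd (h.trans h'.symm) hne

/-- M is covered by two 1-Lipschitz images of each of countably many pieces of N, so its measure is
at most twice that of N. -/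
theorem IsSheetSwap.hausdorffMeasure_lt_top [MeasurableSpace M] [BorelSpace M]
    [MeasurableSpace N] [BorelSpace N] (hτ : IsSheetSwap p τ) (hp : IsLocalIsometry p)
    (hsurj : Function.Surjective p) {d : ℝ} (hd : 0 ≤ d)
    (h : Measure.hausdorffMeasure d (Set.univ : Set N) < ⊤) :
    Measure.hausdorffMeasure d (Set.univ : Set M) < ⊤ := by
  rcases isEmpty_or_nonempty M with hM | ⟨⟨m⟩⟩
  · simp [Set.univ_eq_empty_iff.2 hM]
  have := secondCountableTopology_of_hausdorffMeasure_lt_top h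
  choose V hV hyV q q' hq hq' hcov using hτ.exists_sections hp hsurj
  obtain ⟨s, hs, hsV⟩ := TopologicalSpace.countable_cover_nhds fun y => (hV y).mem_nhds (hyV y)
  have hsne : s.Nonempty := by
    have : p m ∈ ⋃ x ∈ s, V x := hsV ▸ Set.mem_univ _
    obtain ⟨y, hy, -⟩ := Set.mem_iUnion₂.1 this
    exact ⟨y, hy⟩
  obtain ⟨u, rfl⟩ := hs.exists_eq_range hsne
  -- The pieces are made disjoint and measurable so that their measures add up exactly to that of N.
  set C := disjointed fun i => V (u i) with hC
  have hCV : ∀ i, C i ⊆ V (u i) := fun i => disjointed_subset _ i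
  have hCuniv : ⋃ i, C i = Set.univ := by
    rw [hC, iUnion_disjointed, ← hsV, Set.biUnion_range]
  have hsub : (Set.univ : Set M) ⊆ ⋃ i, (q (u i) '' C i ∪ q' (u i) '' C i) := by
    intro x _
    have : p x ∈ ⋃ i, C i := hCuniv ▸ Set.mem_univ _
    obtain ⟨i, hi⟩ := Set.mem_iUnion.1 this
    refine Set.mem_iUnion.2 ⟨i, ?_⟩
    rcases hcov (u i) x (hCV i hi) with hx | hx
    · exact Or.inl ⟨p x, hi, hx.symm⟩
    · exact Or.inr ⟨p x, hi, hx.symm⟩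
  calc Measure.hausdorffMeasure d (Set.univ : Set M)
      ≤ ∑' i, Measure.hausdorffMeasure d (q (u i) '' C i ∪ q' (u i) '' C i) :=
        (measure_mono hsub).trans (measure_iUnion_le _)
    _ ≤ ∑' i, 2 * Measure.hausdorffMeasure d (C i) := by
        refine ENNReal.tsum_le_tsum fun i => (measure_union_le _ _).trans ?_
        have h1 := ((hq (u i)).mono (hCV i)).hausdorffMeasure_image_le hd
        have h2 := ((hq' (u i)).mono (hCV i)).hausdorffMeasure_image_le hd
        simp only [ENNReal.coe_one, ENNReal.one_rpow, one_mul] at h1 h2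
        rw [two_mul]
        exact add_le_add h1 h2
    _ = 2 * Measure.hausdorffMeasure d (Set.univ : Set N) := by
        rw [ENNReal.tsum_mul_left, ← hCuniv, measure_iUnion (disjoint_disjointed _)]
        intro i
        exact MeasurableSet.disjointed (fun j => (hV (u j)).measurableSet) i
    _ < ⊤ := ENNReal.mul_lt_top (by simp) h

theorem IsSheetSwap.hasFiniteVolume (hτ : IsSheetSwap p τ) (hp : IsLocalIsometry p)
    (hsurj : Function.Surjective p) {n : ℕ} (h : HasFiniteVolume n N) : HasFiniteVolume n M := by
  borelize M N
  have h1 : Measure.hausdorffMeasure (n : ℝ) (Set.univ : Set N) < ⊤ := by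
    have := h
    unfold HasFiniteVolume at this
    convert this
  have h2 := hτ.hausdorffMeasure_lt_top hp hsurj n.cast_nonneg h1
  unfold HasFiniteVolume
  convert h2

end Volume

/-! ### Local sides of a hypersurface. -/

section Sides

variable {n : ℕ} {X : Type*} [MetricSpace X] {S : Set X}
  {e : OpenPartialHomeomorph X (EuclideanSpace ℝ (Fin (n + 1)))} {m : X}

/-- A half ball in the chart is convex, hence connected, and misses S; it cannot meet both of two
disjoint open sets that cover it. -/
theorem IsAdaptedChart.eventually_positive_imp (he : IsAdaptedChart n S e) (hm : m ∈ e.source)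
    {A B : Set X} (hA : IsOpen A) (hB : IsOpen B) (hAB : Disjoint A B)
    (hcov : ∀ᶠ y in 𝓝 m, y ∉ S → y ∈ A ∪ B) :
    (∀ᶠ y in 𝓝 m, 0 < e y (Fin.last n) → y ∈ A) ∨
      ∀ᶠ y in 𝓝 m, 0 < e y (Fin.last n) → y ∈ B := by
  have h1 : Tendsto e.symm (𝓝 (e m)) (𝓝 m) := by
    have := e.continuousAt_symm (e.map_source hm)
    rwa [ContinuousAt, e.left_inv hm] at this
  obtain ⟨ε, hε, hball⟩ := Metric.mem_nhds_iff.1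
    (inter_mem (e.open_target.mem_nhds (e.map_source hm)) (h1.eventually hcov))
  set H := Metric.ball (e m) ε ∩ {v | 0 < v (Fin.last n)} with hH
  have hHconv : Convex ℝ H :=
    (convex_ball _ _).inter (convex_halfSpace_gt
      (EuclideanSpace.proj (𝕜 := ℝ) (Fin.last n)).toLinearMap.isLinear 0)
  have hpre : IsPreconnected (e.symm '' H) :=
    hHconv.isPreconnected.image _ (e.continuousOn_symm.mono fun v hv => (hball hv.1).1)
  have hsub : e.symm '' H ⊆ A ∪ B := by
    rintro _ ⟨v, hv, rfl⟩
    refine (hball hv.1).2 fun hS => ?_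
    rw [he.mem_iff _ (e.map_target (hball hv.1).1), e.right_inv (hball hv.1).1] at hS
    exact hv.2.ne' hS
  have key : ∀ {A : Set X}, e.symm '' H ⊆ A → ∀ᶠ y in 𝓝 m, 0 < e y (Fin.last n) → y ∈ A := by
    intro A hA
    filter_upwards [e.open_source.mem_nhds hm,
      (e.continuousAt hm).preimage_mem_nhds (Metric.ball_mem_nhds _ hε)] with y hy hyb hy0
    exact hA ⟨e y, ⟨hyb, hy0⟩, e.left_inv hy⟩
  exact (hpre.subset_or_subset hA hB hAB hsub).imp key key

theorem IsAdaptedChart.frequently_positive (he : IsAdaptedChart n S e) (hm : m ∈ e.source)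
    (hmS : m ∈ S) : ∃ᶠ y in 𝓝 m, 0 < e y (Fin.last n) := by
  intro h
  have := eventually_mem_positive_side (s := ⟨m, hmS⟩) hm (P := fun _ => False) h he
  obtain ⟨_, h⟩ := this.exists
  exact h

/-- The set `A` lies on the positive side and the set `B` on the negative side of the hypersurface
near `m`. -/
def SidesAt (e : OpenPartialHomeomorph X (EuclideanSpace ℝ (Fin (n + 1)))) (A B : Set X)
    (m : X) : Prop :=
  ∀ᶠ y in 𝓝 m, (0 < e y (Fin.last n) → y ∈ A) ∧ (e y (Fin.last n) < 0 → y ∈ B)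

/-- Each half ball lies in A or in B. They cannot both lie in the same one, since the other set is
adherent to m. -/
theorem IsAdaptedChart.sidesAt_or_sidesAt (he : IsAdaptedChart n S e) (hm : m ∈ e.source)
    {A B : Set X} (hA : IsOpen A) (hB : IsOpen B) (hAB : Disjoint A B)
    (hAS : Disjoint A S) (hBS : Disjoint B S)
    (hcov : ∀ᶠ y in 𝓝 m, y ∉ S → y ∈ A ∪ B) (hmA : m ∈ closure A) (hmB : m ∈ closure B) :
    SidesAt e A B m ∨ SidesAt e B A m := by
  have h1 := he.eventually_positive_imp hm hA hB hAB hcov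
  have h2 := (he.reflectChart (Fin.last n)).eventually_positive_imp hm hA hB hAB hcov
  simp only [reflectChart_apply, coordReflection_apply_self, Left.neg_pos_iff] at h2
  have key : ∀ {A B : Set X}, Disjoint A B → Disjoint B S → m ∈ closure B →
      (∀ᶠ y in 𝓝 m, 0 < e y (Fin.last n) → y ∈ A) →
      (∀ᶠ y in 𝓝 m, e y (Fin.last n) < 0 → y ∈ A) → False := by
    intro A B hAB hBS hmB hp hn
    obtain ⟨y, hyB, hy⟩ := ((mem_closure_iff_frequently.1 hmB).and_eventually
      ((hp.and hn).and (e.open_source.mem_nhds hm))).exists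
    rcases lt_trichotomy (e y (Fin.last n)) 0 with h | h | h
    · exact Set.disjoint_left.1 hAB (hy.1.2 h) hyB
    · exact Set.disjoint_left.1 hBS hyB ((he.mem_iff y hy.2).2 h)
    · exact Set.disjoint_left.1 hAB (hy.1.1 h) hyB
  rcases h1 with h1 | h1 <;> rcases h2 with h2 | h2
  · exact (key hAB hBS hmB h1 h2).elim
  · exact Or.inl (h1.and h2)
  · exact Or.inr (h1.and h2)
  · exact (key hAB.symm hAS hmA h1 h2).elim

theorem SidesAt.eventually_iff {A B : Set X} (h : SidesAt e A B m) (he : IsAdaptedChart n S e)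
    (hm : m ∈ e.source) (hAB : Disjoint A B) (hAS : Disjoint A S) (hBS : Disjoint B S) :
    ∀ᶠ y in 𝓝 m, (y ∈ A ↔ 0 < e y (Fin.last n)) ∧ (y ∈ B ↔ e y (Fin.last n) < 0) := by
  filter_upwards [h, e.open_source.mem_nhds hm] with y hy hye
  rcases lt_trichotomy (e y (Fin.last n)) 0 with h | h | h
  · exact ⟨⟨fun hA => (Set.disjoint_left.1 hAB hA (hy.2 h)).elim, fun h' => (h.not_gt h').elim⟩,
      fun _ => h, hy.2⟩
  · have hS := (he.mem_iff y hye).2 h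
    exact ⟨⟨fun hA => (Set.disjoint_left.1 hAS hA hS).elim, hy.1⟩,
      fun hB => (Set.disjoint_left.1 hBS hB hS).elim, hy.2⟩
  · exact ⟨⟨fun _ => h, hy.1⟩,
      fun hB => (Set.disjoint_left.1 hAB (hy.1 h) hB).elim, fun h' => (h.not_gt h').elim⟩

theorem IsAdaptedChart.eventually_sides (he : IsAdaptedChart n S e) (hm : m ∈ e.source)
    {A B : Set X} (hA : IsOpen A) (hB : IsOpen B) (hAB : Disjoint A B)
    (hAS : Disjoint A S) (hBS : Disjoint B S)
    (hcov : ∀ᶠ y in 𝓝 m, y ∉ S → y ∈ A ∪ B) (hmA : m ∈ closure A) (hmB : m ∈ closure B) :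
    (∀ᶠ y in 𝓝 m, (y ∈ A ↔ 0 < e y (Fin.last n)) ∧ (y ∈ B ↔ e y (Fin.last n) < 0)) ∨
      ∀ᶠ y in 𝓝 m, (y ∈ B ↔ 0 < e y (Fin.last n)) ∧ (y ∈ A ↔ e y (Fin.last n) < 0) :=
  (he.sidesAt_or_sidesAt hm hA hB hAB hAS hBS hcov hmA hmB).imp
    (fun h => h.eventually_iff he hm hAB hAS hBS)
    fun h => h.eventually_iff he hm hAB.symm hBS hAS

theorem SidesAt.mem_closure {A B : Set X} (h : SidesAt e A B m) (he : IsAdaptedChart n S e)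
    (hm : m ∈ e.source) (hmS : m ∈ S) : m ∈ closure A ∧ m ∈ closure B := by
  constructor <;> rw [mem_closure_iff_frequently]
  · exact ((he.frequently_positive hm hmS).and_eventually h).mono fun y hy => hy.2.1 hy.1
  · have := (he.reflectChart (Fin.last n)).frequently_positive hm hmS
    simp only [reflectChart_apply, coordReflection_apply_self, Left.neg_pos_iff] at this
    exact (this.and_eventually h).mono fun y hy => hy.2.2 hy.1

end Sides

/-! ### Halves of the complement of the preimage of S. -/

section Half

variable {M N : Type*} [MetricSpace M] {p : M → N} {τ : M → M} {S : Set N} {D : Set M}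

/-- The set `D` is one of two halves, interchanged by the sheet swap, of the complement of the
preimage of `S`. -/
structure IsHalf (p : M → N) (τ : M → M) (S : Set N) (D : Set M) : Prop where
  isOpen : IsOpen D
  notMem : ∀ x ∈ D, p x ∉ S
  mem_or : ∀ x, p x ∉ S → x ∈ D ∨ τ x ∈ D
  swap_notMem : ∀ x ∈ D, τ x ∉ D

namespace IsHalf

theorem disjoint (hD : IsHalf p τ S D) : Disjoint D (τ ⁻¹' D) :=
  Set.disjoint_left.2 fun x hx => hD.swap_notMem x hx

theorem disjoint_preimage (hD : IsHalf p τ S D) : Disjoint D (p ⁻¹' S) :=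
  Set.disjoint_left.2 fun x hx => hD.notMem x hx

theorem swap_disjoint_preimage (hD : IsHalf p τ S D) (hτ : IsSheetSwap p τ) :
    Disjoint (τ ⁻¹' D) (p ⁻¹' S) :=
  Set.disjoint_left.2 fun x hx hS => hD.notMem _ hx (by rwa [hτ.map_eq])

end IsHalf

end Half

section Halves

variable {n : ℕ} {M N : Type*} [MetricSpace M] [MetricSpace N] {p : M → N} {τ : M → M}
  {S : Set N} {D : Set M}

namespace IsHalf

theorem isOpen_swap (hD : IsHalf p τ S D) (hτ : IsSheetSwap p τ) (hp : IsLocalIsometry p) :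
    IsOpen (τ ⁻¹' D) :=
  hD.isOpen.preimage (hτ.isLocalIsometry hp).continuous

theorem sidesAt_of_mem_closure (hD : IsHalf p τ S D) (hτ : IsSheetSwap p τ)
    (hp : IsLocalIsometry p)
    {e : OpenPartialHomeomorph M (EuclideanSpace ℝ (Fin (n + 1)))}
    (he : IsAdaptedChart n (p ⁻¹' S) e) {m : M} (hm : m ∈ e.source)
    (h1 : m ∈ closure D) (h2 : m ∈ closure (τ ⁻¹' D)) :
    SidesAt e D (τ ⁻¹' D) m ∨ SidesAt e (τ ⁻¹' D) D m :=
  he.sidesAt_or_sidesAt hm hD.isOpen (hD.isOpen_swap hτ hp) hD.disjoint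
    hD.disjoint_preimage (hD.swap_disjoint_preimage hτ)
    (Eventually.of_forall fun y hy => hD.mem_or y hy) h1 h2

theorem eventually_sides (hD : IsHalf p τ S D) (hτ : IsSheetSwap p τ) (hp : IsLocalIsometry p)
    {e : OpenPartialHomeomorph M (EuclideanSpace ℝ (Fin (n + 1)))}
    (he : IsAdaptedChart n (p ⁻¹' S) e) {m : M} (hm : m ∈ e.source)
    (h1 : m ∈ closure D) (h2 : m ∈ closure (τ ⁻¹' D)) :
    (∀ᶠ y in 𝓝 m, (y ∈ D ↔ 0 < e y (Fin.last n)) ∧ (τ y ∈ D ↔ e y (Fin.last n) < 0)) ∨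
      ∀ᶠ y in 𝓝 m, (τ y ∈ D ↔ 0 < e y (Fin.last n)) ∧ (y ∈ D ↔ e y (Fin.last n) < 0) :=
  he.eventually_sides hm hD.isOpen (hD.isOpen_swap hτ hp) hD.disjoint
    hD.disjoint_preimage (hD.swap_disjoint_preimage hτ)
    (Eventually.of_forall fun y hy => hD.mem_or y hy) h1 h2

theorem swap_mem_closure (hτ : IsSheetSwap p τ) (hp : IsLocalIsometry p) {m : M}
    (h : m ∈ closure D ∧ m ∈ closure (τ ⁻¹' D)) :
    τ m ∈ closure D ∧ τ m ∈ closure (τ ⁻¹' D) := by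
  have hc := (hτ.isLocalIsometry hp).continuous
  refine ⟨map_mem_closure hc h.2 fun x hx => hx, map_mem_closure hc h.1 fun x hx => ?_⟩
  rwa [Set.mem_preimage, hτ.involutive]

/-- Both halves are adherent to every point of the preimage of `S`. -/
theorem mem_closure [PreconnectedSpace M] (hD : IsHalf p τ S D) (hτ : IsSheetSwap p τ)
    (hp : IsLocalIsometry p) (hsurj : Function.Surjective p)
    (hS : IsTotallyGeodesicHypersurface n S) (hSc : IsPreconnected S)
    {m : M} (hm : p m ∈ S) : m ∈ closure D ∧ m ∈ closure (τ ⁻¹' D) := by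
  have hpre := hS.preimage hp
  -- Within Σ the set K is closed, and it is open by the local picture of the sides. It is invariant
  -- under τ, so by connectedness of S it contains all of Σ or none of it. In the latter case the
  -- closures of D and τ D would be disjoint and would separate the connected M.
  set K := closure D ∩ closure (τ ⁻¹' D) with hK
  have hKclosed : IsClosed K := isClosed_closure.inter isClosed_closure
  have hunion : ∀ x, x ∈ closure D ∪ closure (τ ⁻¹' D) := by
    intro x
    rw [← closure_union]
    by_cases hx : p x ∈ S
    · obtain ⟨e, he, hxe⟩ := hpre.exists_chart hx
      rw [mem_closure_iff_frequently]
      refine ((he.frequently_positive hxe hx).and_eventually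
        (e.open_source.mem_nhds hxe)).mono fun y hy => ?_
      refine hD.mem_or y fun hyS => hy.1.ne' ?_
      exact (he.mem_iff y hy.2).1 hyS
    · exact subset_closure (hD.mem_or x hx)
  have hGood : ∀ x ∈ K, p x ∈ S → ∀ᶠ y in 𝓝 x, p y ∈ S → y ∈ K := by
    intro x hx hxS
    obtain ⟨e, he, hxe⟩ := hpre.exists_chart hxS
    rcases hD.sidesAt_of_mem_closure hτ hp he hxe hx.1 hx.2 with h | h
    · filter_upwards [eventually_eventually_nhds.2 h, e.open_source.mem_nhds hxe] with y hy hye hyS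
      exact SidesAt.mem_closure hy he hye hyS
    · filter_upwards [eventually_eventually_nhds.2 h, e.open_source.mem_nhds hxe] with y hy hye hyS
      exact (SidesAt.mem_closure hy he hye hyS).symm
  by_contra hmK
  have hnone : ∀ x, p x ∈ S → x ∉ K := by
    intro x hxS hxK
    obtain ⟨s, hsS, ⟨a, ha, hsa⟩, b, hb, hsb⟩ := hSc _ _
      (hp.isOpenMap _ (isOpen_interior (s := {y | p y ∈ S → y ∈ K})))
      (hp.isOpenMap _ hKclosed.isOpen_compl) (fun s hs => by
        by_cases h : ∃ x, p x = s ∧ x ∈ K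
        · obtain ⟨x, rfl, hx⟩ := h
          exact Or.inl ⟨x, mem_interior_iff_mem_nhds.2 (hGood x hx hs), rfl⟩
        · obtain ⟨x, rfl⟩ := hsurj s
          exact Or.inr ⟨x, fun hx => h ⟨x, rfl, hx⟩, rfl⟩)
      ⟨p x, hxS, x, mem_interior_iff_mem_nhds.2 (hGood x hxK hxS), rfl⟩
      ⟨p m, hm, m, hmK, rfl⟩
    have haK : a ∈ K := interior_subset (s := {y | p y ∈ S → y ∈ K}) ha (by rwa [hsa])
    rcases hτ.eq_or_eq a b (hsb.trans hsa.symm) with h | h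
    · exact hb (h ▸ haK)
    · exact hb (h ▸ swap_mem_closure hτ hp haK)
  have hdisj : ∀ x, x ∉ K := by
    intro x hx
    by_cases hxS : p x ∈ S
    · exact hnone x hxS hx
    · rcases hD.mem_or x hxS with h | h
      · exact Set.disjoint_left.1 (hD.disjoint.closure_right hD.isOpen) h hx.2
      · exact Set.disjoint_left.1
          (hD.disjoint.symm.closure_right (hD.isOpen_swap hτ hp)) h hx.1
  have hboth : ∀ x, x ∈ closure D → τ x ∈ closure (τ ⁻¹' D) := fun x hx =>
    map_mem_closure (hτ.isLocalIsometry hp).continuous hx fun y hy => by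
      rwa [Set.mem_preimage, hτ.involutive]
  have hboth' : ∀ x, x ∈ closure (τ ⁻¹' D) → τ x ∈ closure D := fun x hx =>
    map_mem_closure (hτ.isLocalIsometry hp).continuous hx fun y hy => hy
  have hne : (closure D).Nonempty ∧ (closure (τ ⁻¹' D)).Nonempty := by
    rcases hunion m with h | h
    · exact ⟨⟨m, h⟩, ⟨τ m, hboth m h⟩⟩
    · exact ⟨⟨τ m, hboth' m h⟩, ⟨m, h⟩⟩
  obtain ⟨x, -, hx⟩ := isPreconnected_closed_iff.1 isPreconnected_univ _ _ isClosed_closure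
    isClosed_closure (fun x _ => hunion x) (by simpa using hne.1) (by simpa using hne.2)
  exact hdisj x hx

end IsHalf

/-- If the preimage of a connected set is not connected, then the sheet swap interchanges the two
parts of a separation. -/
theorem IsSheetSwap.exists_separation (hτ : IsSheetSwap p τ) (hp : IsLocalIsometry p)
    (hsurj : Function.Surjective p) {T : Set N} (hT : IsPreconnected T)
    (h : ¬ IsPreconnected (p ⁻¹' T)) : ∃ u v : Set M, IsOpen u ∧ IsOpen v ∧ p ⁻¹' T ⊆ u ∪ v ∧
      (∀ x, p x ∈ T → x ∈ u → x ∉ v) ∧ ∀ x, p x ∈ T → (x ∈ u ↔ τ x ∈ v) := by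
  simp only [IsPreconnected, not_forall] at h
  obtain ⟨u, v, hu, hv, hcov, ⟨a, haT, hau⟩, ⟨b, hbT, hbv⟩, hno⟩ := h
  have hno : ∀ x, p x ∈ T → x ∈ u → x ∉ v := fun x hx hxu hxv => hno ⟨x, hx, hxu, hxv⟩
  have hc := (hτ.isLocalIsometry hp).continuous
  have hcov' : ∀ x, p x ∈ T → x ∈ u ∨ x ∈ v := fun x hx => hcov hx
  have hcovτ : ∀ x, p x ∈ T → τ x ∈ u ∨ τ x ∈ v := fun x hx => hcov' _ (by rwa [hτ.map_eq])
  have hnoτ : ∀ x, p x ∈ T → τ x ∈ u → τ x ∉ v := fun x hx => hno _ (by rwa [hτ.map_eq])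
  have hopen : ∀ {u v : Set M}, IsOpen u → IsOpen v → IsOpen (p '' (u ∩ τ ⁻¹' v)) :=
    fun hu hv => hp.isOpenMap _ (hu.inter (hv.preimage hc))
  have hmem : ∀ {u v : Set M}, ∀ x, p x ∈ p '' (u ∩ τ ⁻¹' v) →
      (x ∈ u ∧ τ x ∈ v) ∨ (τ x ∈ u ∧ x ∈ v) := by
    rintro u v x ⟨y, ⟨hyu, hyv⟩, hyx⟩
    rcases hτ.eq_or_eq x y hyx with rfl | rfl
    · exact Or.inl ⟨hyu, hyv⟩
    · rw [Set.mem_preimage, hτ.involutive] at hyv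
      exact Or.inr ⟨hyu, hyv⟩
  -- T is divided by whether the two lifts of a point lie in different parts or in the same part.
  -- Only one of these can occur on a connected T. If it were the second, the points with both lifts
  -- in u and those with both lifts in v would separate T.
  have hfirst : T ⊆ p '' (u ∩ τ ⁻¹' v) ∪ (p '' (u ∩ τ ⁻¹' u) ∪ p '' (v ∩ τ ⁻¹' v)) := by
    intro t ht
    obtain ⟨x, rfl⟩ := hsurj t
    rcases hcov' x ht with h1 | h1 <;> rcases hcovτ x ht with h2 | h2
    · exact Or.inr (Or.inl ⟨x, ⟨h1, h2⟩, rfl⟩)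
    · exact Or.inl ⟨x, ⟨h1, h2⟩, rfl⟩
    · exact Or.inl ⟨τ x, ⟨h2, by rwa [Set.mem_preimage, hτ.involutive]⟩, hτ.map_eq x⟩
    · exact Or.inr (Or.inr ⟨x, ⟨h1, h2⟩, rfl⟩)
  refine ⟨u, v, hu, hv, hcov, hno, ?_⟩
  by_cases hW : (T ∩ p '' (u ∩ τ ⁻¹' v)).Nonempty
  · have hW' : ¬ (T ∩ (p '' (u ∩ τ ⁻¹' u) ∪ p '' (v ∩ τ ⁻¹' v))).Nonempty := by
      intro hW'
      obtain ⟨t, ht, h1, h2⟩ := hT _ _ (hopen hu hv) ((hopen hu hu).union (hopen hv hv)) hfirst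
        hW hW'
      obtain ⟨x, rfl⟩ := hsurj t
      have n1 := hno x ht
      have n2 := hnoτ x ht
      rcases h2 with h2 | h2 <;> rcases hmem x h1 with h1 | h1 <;> rcases hmem x h2 with h2 | h2 <;>
        tauto
    intro x hx
    refine ⟨fun h1 => ?_, fun h1 => ?_⟩
    · refine (hcovτ x hx).resolve_left fun h2 => hW' ⟨p x, hx, Or.inl ⟨x, ⟨h1, h2⟩, rfl⟩⟩
    · refine (hcov' x hx).resolve_right fun h2 => hW' ⟨p x, hx, Or.inr ⟨x, ⟨h2, h1⟩, rfl⟩⟩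
  · have hsub : T ⊆ p '' (u ∩ τ ⁻¹' u) ∪ p '' (v ∩ τ ⁻¹' v) := fun t ht =>
      (hfirst ht).resolve_left fun h1 => hW ⟨t, ht, h1⟩
    have ha : (T ∩ p '' (u ∩ τ ⁻¹' u)).Nonempty := by
      refine ⟨p a, haT, a, ⟨hau, ?_⟩, rfl⟩
      exact (hcovτ a haT).resolve_right fun h2 => hW ⟨p a, haT, a, ⟨hau, h2⟩, rfl⟩
    have hb : (T ∩ p '' (v ∩ τ ⁻¹' v)).Nonempty := by
      refine ⟨p b, hbT, b, ⟨hbv, ?_⟩, rfl⟩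
      refine (hcovτ b hbT).resolve_left fun h2 => hW ⟨p b, hbT, τ b, ⟨h2, ?_⟩, hτ.map_eq b⟩
      rwa [Set.mem_preimage, hτ.involutive]
    obtain ⟨t, ht, h1, h2⟩ := hT _ _ (hopen hu hu) (hopen hv hv) hsub ha hb
    obtain ⟨x, rfl⟩ := hsurj t
    have n1 := hno x ht
    have n2 := hnoτ x ht
    rcases hmem x h1 with h1 | h1 <;> rcases hmem x h2 with h2 | h2 <;> tauto

theorem IsSheetSwap.exists_isHalf (hτ : IsSheetSwap p τ) (hp : IsLocalIsometry p)
    (hsurj : Function.Surjective p) (hSclosed : IsClosed S) (hS : IsPreconnected Sᶜ)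
    (h : ¬ IsPreconnected (p ⁻¹' S)ᶜ) : ∃ D, IsHalf p τ S D := by
  obtain ⟨u, v, hu, hv, hcov, hno, hiff⟩ := hτ.exists_separation hp hsurj hS h
  have hτS : ∀ x, p x ∉ S → p (τ x) ∉ S := fun x hx => by rwa [hτ.map_eq]
  refine ⟨u ∩ p ⁻¹' Sᶜ, hu.inter (hSclosed.isOpen_compl.preimage hp.continuous),
    fun x hx => hx.2, fun x hx => ?_, fun x hx hx' => ?_⟩
  · rcases hcov hx with h1 | h1
    · exact Or.inl ⟨h1, hx⟩
    · refine Or.inr ⟨?_, hτS x hx⟩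
      rw [hiff _ (hτS x hx), hτ.involutive]
      exact h1
  · exact hno _ (hτS x hx.2) hx'.1 ((hiff x hx.2).1 hx.1)

end Halves

/-! ### Consequences of a half for S and its complement. -/

section FromHalf

variable {n : ℕ} {M N : Type*} [MetricSpace M] [MetricSpace N] {p : M → N} {τ : M → M}
  {S : Set N} {D : Set M}

local notation "𝔼" n => EuclideanSpace ℝ (Fin n)

namespace IsHalf

/-- On D the covering is a bijection onto the complement of S; its inverse is a local isometry into
M, along which the orientation pulls back. -/
theorem isOrientable_compl (hD : IsHalf p τ S D) (hτ : IsSheetSwap p τ) (hp : IsLocalIsometry p)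
    (hsurj : Function.Surjective p) (hS : IsClosed S) (hM : IsOrientable n M) :
    IsOrientable n (Sᶜ : Set N) := by
  have hex : ∀ y : (Sᶜ : Set N), ∃ x ∈ D, p x = y := by
    rintro ⟨y, hy⟩
    obtain ⟨x, rfl⟩ := hsurj y
    rcases hD.mem_or x hy with h | h
    · exact ⟨x, h, rfl⟩
    · exact ⟨τ x, h, hτ.map_eq x⟩
  choose q hqD hq using hex
  refine hM.of_isLocalIsometry (f := q) (hp.of_comp ?_ ?_)
  · rw [continuous_iff_continuousAt]
    intro y W hW
    rw [mem_map]
    have h1 : p '' (W ∩ D) ∈ 𝓝 (y : N) := by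
      rw [← hq y]
      exact hp.isOpenMap.image_mem_nhds (inter_mem hW (hD.isOpen.mem_nhds (hqD y)))
    filter_upwards [continuous_subtype_val.continuousAt.preimage_mem_nhds h1] with z hz
    obtain ⟨w, hw, hwz⟩ := hz
    rcases hτ.eq_or_eq w (q z) ((hq z).trans hwz.symm) with h | h
    · rw [Set.mem_preimage, h]
      exact hw.1
    · exact (hD.swap_notMem w hw.2 (h ▸ hqD z)).elim
  · have : p ∘ q = Subtype.val := funext hq
    rw [this]
    exact IsLocalIsometry.subtype_val hS.isOpen_compl

/-- Pull two sides U and V of S back to M. Near each point of Σ the set D agrees with exactly one of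
the pullbacks. Which one is locally constant along Σ, yet τ changes it, so a connected Σ is
impossible. -/
theorem isOneSided [PreconnectedSpace M] (hD : IsHalf p τ S D) (hτ : IsSheetSwap p τ)
    (hp : IsLocalIsometry p) (hsurj : Function.Surjective p)
    (hS : IsTotallyGeodesicHypersurface n S) (hSc : IsPreconnected S) (hne : S.Nonempty)
    (hconn : IsPreconnected (p ⁻¹' S)) : IsOneSided S := by
  rintro ⟨U, V, hU, hV, hUV, hUS, hVS, hopen, hclU, hclV⟩
  have hpre := hS.preimage hp
  have hcov : ∀ m, p m ∈ S → ∀ᶠ y in 𝓝 m, y ∉ p ⁻¹' S → y ∈ p ⁻¹' U ∪ p ⁻¹' V := by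
    intro m hm
    filter_upwards [hp.continuous.continuousAt.preimage_mem_nhds
      (hopen.mem_nhds (Or.inl (Or.inr hm)))] with y hy hyS
    rcases hy with (hy | hy) | hy
    · exact Or.inl hy
    · exact (hyS hy).elim
    · exact Or.inr hy
  have key : ∀ m, p m ∈ S → (∀ᶠ y in 𝓝 m, y ∈ D ↔ p y ∈ U) ∨ (∀ᶠ y in 𝓝 m, y ∈ D ↔ p y ∈ V) := by
    intro m hm
    obtain ⟨e, he, hme⟩ := hpre.exists_chart hm
    have h1 := hD.mem_closure hτ hp hsurj hS hSc hm
    have h2 := he.eventually_sides hme (hU.preimage hp.continuous) (hV.preimage hp.continuous)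
      (hUV.preimage p) (hUS.preimage p) (hVS.preimage p) (hcov m hm)
      (hp.isOpenMap.preimage_closure_subset_closure_preimage (hclU hm))
      (hp.isOpenMap.preimage_closure_subset_closure_preimage (hclV hm))
    rcases hD.eventually_sides hτ hp he hme h1.1 h1.2 with h | h <;> rcases h2 with h2 | h2
    · left; filter_upwards [h, h2] with y hy hy'; exact hy.1.trans hy'.1.symm
    · right; filter_upwards [h, h2] with y hy hy'; exact hy.1.trans hy'.1.symm
    · right; filter_upwards [h, h2] with y hy hy'; exact hy.2.trans hy'.2.symm
    · left; filter_upwards [h, h2] with y hy hy'; exact hy.2.trans hy'.2.symm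
  have hc := (hτ.isLocalIsometry hp).continuous
  have swap : ∀ {A B : Set N}, Disjoint A B → Disjoint A S → Disjoint B S → ∀ m, p m ∈ S →
      (∀ᶠ y in 𝓝 m, y ∉ p ⁻¹' S → y ∈ p ⁻¹' A ∪ p ⁻¹' B) →
      (∀ᶠ y in 𝓝 m, y ∈ D ↔ p y ∈ A) → ∀ᶠ y in 𝓝 (τ m), y ∈ D ↔ p y ∈ B := by
    intro A B hAB hAS hBS m hm hcov h
    have ht : Tendsto τ (𝓝 (τ m)) (𝓝 m) := by
      have := hc.tendsto (τ m)
      rwa [hτ.involutive] at this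
    filter_upwards [ht.eventually h, ht.eventually hcov] with y hy hy'
    simp only [Set.mem_preimage, Set.mem_union, hτ.map_eq] at hy hy'
    have h1 := hD.swap_notMem y
    have h2 := hD.mem_or y
    have h3 := hD.notMem y
    have h4 : p y ∈ A → p y ∉ B := fun h => Set.disjoint_left.1 hAB h
    have h5 : p y ∈ B → p y ∉ S := fun h => Set.disjoint_left.1 hBS h
    tauto
  obtain ⟨s, hs⟩ := hne
  obtain ⟨m, rfl⟩ := hsurj s
  have hτm : p (τ m) ∈ S := by rwa [hτ.map_eq]
  have hboth : (p ⁻¹' S ∩ {m | ∀ᶠ y in 𝓝 m, y ∈ D ↔ p y ∈ U}).Nonempty ∧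
      (p ⁻¹' S ∩ {m | ∀ᶠ y in 𝓝 m, y ∈ D ↔ p y ∈ V}).Nonempty := by
    rcases key m hs with h | h
    · exact ⟨⟨m, hs, h⟩, ⟨τ m, hτm, swap hUV hUS hVS m hs (hcov m hs) h⟩⟩
    · refine ⟨⟨τ m, hτm, swap hUV.symm hVS hUS m hs ?_ h⟩, ⟨m, hs, h⟩⟩
      simpa only [Set.union_comm] using hcov m hs
  obtain ⟨x, hxS, hx1, hx2⟩ := hconn _ _ isOpen_setOfPred_eventually_nhds isOpen_setOfPred_eventually_nhds
    (fun x hx => key x hx) hboth.1 hboth.2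
  obtain ⟨y, hyU, hy1, hy2⟩ := ((mem_closure_iff_frequently.1
    (hp.isOpenMap.preimage_closure_subset_closure_preimage (hclU hxS))).and_eventually
      (hx1.and hx2)).exists
  exact Set.disjoint_left.1 hUV hyU (hy2.1 (hy1.2 hyU))

/-- Adapted charts of `N` that are positive at `m` and whose positive side corresponds to `D`. -/
theorem exists_positive_adapted_chart [PreconnectedSpace M] (hD : IsHalf p τ S D)
    (hτ : IsSheetSwap p τ) (hp : IsLocalIsometry p) (hsurj : Function.Surjective p)
    (hS : IsTotallyGeodesicHypersurface (n + 1) S) (hSc : IsPreconnected S)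
    {c : M → OpenPartialHomeomorph M (𝔼 (n + 2))} (hc : IsOrientedChoice c) {m : M}
    (hm : p m ∈ S) :
    ∃ e : OpenPartialHomeomorph N (𝔼 (n + 2)), IsAdaptedChart (n + 1) S e ∧ p m ∈ e.source ∧
      orientationSign p (c m) e m = 1 ∧
      ∀ᶠ y in 𝓝 m, (y ∈ D ↔ 0 < e (p y) (Fin.last (n + 1))) ∧
        (τ y ∈ D ↔ e (p y) (Fin.last (n + 1)) < 0) := by
  have hside : ∃ e : OpenPartialHomeomorph N (𝔼 (n + 2)), IsAdaptedChart (n + 1) S e ∧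
      p m ∈ e.source ∧ ∀ᶠ y in 𝓝 m, (y ∈ D ↔ 0 < e (p y) (Fin.last (n + 1))) ∧
        (τ y ∈ D ↔ e (p y) (Fin.last (n + 1)) < 0) := by
    obtain ⟨e, he, hme⟩ := hS.exists_chart hm
    obtain ⟨e₁, he₁, hme₁, -, h⟩ := he.exists_pullback hp hme
    have hcl := hD.mem_closure hτ hp hsurj hS hSc hm
    rcases hD.eventually_sides hτ hp he₁ hme₁ hcl.1 hcl.2 with h1 | h1
    · refine ⟨e, he, hme, h1.mono fun y hy => ?_⟩
      rw [← h]
      exact hy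
    · refine ⟨reflectChart (Fin.last _) e, he.reflectChart _, hme, h1.mono fun y hy => ?_⟩
      rw [reflectChart_apply, coordReflection_apply_self, ← h, Left.neg_pos_iff, Left.neg_neg_iff]
      exact ⟨hy.2, hy.1⟩
  obtain ⟨e, he, hme, hes⟩ := hside
  have h0 := orientationSign_ne_zero hp (hc.chart m) he.chart (hc.mem_source m) hme
  rcases h : orientationSign p (c m) e m with _ | _ | _
  · exact absurd h h0
  -- In dimension at least two, coordinate 0 is not the last one, so this reflection corrects the
  -- orientation without exchanging the sides.
  · refine ⟨reflectChart 0 e, he.reflectChart 0, hme, ?_, ?_⟩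
    · rw [orientationSign_reflectChart, h]
      rfl
    · have hne : Fin.last (n + 1) ≠ 0 := (Fin.last_pos).ne'
      simpa only [reflectChart_apply, coordReflection_apply_of_ne hne] using hes
  · exact ⟨e, he, hme, h, hes⟩

/-- The charts of S come from adapted charts of N that match the orientation of M and the
coorientation by D at some lift of the point. Which lift is irrelevant, because τ reverses both. -/
theorem isOrientable_hypersurface [PreconnectedSpace M] (hD : IsHalf p τ S D)
    (hτ : IsSheetSwap p τ) (hp : IsLocalIsometry p) (hsurj : Function.Surjective p)
    (hS : IsTotallyGeodesicHypersurface (n + 1) S) (hSc : IsPreconnected S)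
    {c : M → OpenPartialHomeomorph M (𝔼 (n + 2))} (hc : IsOrientedChoice c)
    (hrev : ∀ x, relativeSign τ c c x = -1) : IsOrientable (n + 1) S := by
  have hex : ∀ s : S, ∃ m, p m = s ∧ ∃ e : OpenPartialHomeomorph N (𝔼 (n + 2)),
      IsAdaptedChart (n + 1) S e ∧ (s : N) ∈ e.source ∧ orientationSign p (c m) e m = 1 ∧
      ∀ᶠ y in 𝓝 m, (y ∈ D ↔ 0 < e (p y) (Fin.last (n + 1))) ∧
        (τ y ∈ D ↔ e (p y) (Fin.last (n + 1)) < 0) := by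
    rintro ⟨s, hs⟩
    obtain ⟨m, rfl⟩ := hsurj s
    exact ⟨m, rfl, hD.exists_positive_adapted_chart hτ hp hsurj hS hSc hc hs⟩
  choose m hm e he hse hsign hside using hex
  have hcτ := (hτ.isLocalIsometry hp).continuous
  refine isOrientable_of_charts (fun s => inducedChart (he s) s)
    (fun s => isHyperbolicChart_inducedChart (he s) s) hse fun s => ?_
  have hsrc : p (m s) ∈ (e s).source := by rw [hm]; exact hse s
  have hev : ∀ᶠ x in 𝓝 (m s), (orientationSign p (c x) (e s) x = 1 ∧ p x ∈ (e s).source) ∧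
      ∀ᶠ y in 𝓝 x, (y ∈ D ↔ 0 < e s (p y) (Fin.last (n + 1))) ∧
        (τ y ∈ D ↔ e s (p y) (Fin.last (n + 1)) < 0) := by
    filter_upwards [hc.eventually_sign_eq hp (he s).chart hsrc,
      hp.continuous.continuousAt.preimage_mem_nhds ((e s).open_source.mem_nhds hsrc),
      eventually_eventually_nhds.2 (hside s)] with x hx hx' hx''
    exact ⟨⟨hx.trans (hsign s), hx'⟩, hx''⟩
  have hev' := hp.eventually_exists hev
  rw [hm] at hev'
  filter_upwards [continuous_subtype_val.continuousAt.eventually hev'] with z hz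
  obtain ⟨x, hxz, ⟨hx1, hx2⟩, hx3⟩ := hz
  have hzs : (z : N) ∈ (e s).source := hxz ▸ hx2
  have hpush : ∀ {P : N → Prop}, (∀ᶠ y in 𝓝 x, P (p y)) → ∀ᶠ w in 𝓝 (z : N), P w := by
    intro P h
    rw [← hxz, ← hp.map_nhds]
    exact h
  have hxz' : p x ∈ (e z).source := hxz ▸ hse z
  have h4 := orientationSign_comp hp IsLocalIsometry.id (hc.chart x) (he s).chart (he z).chart
    (hc.mem_source x) hx2 hxz'
  rw [hx1, one_mul] at h4
  -- If the lift chosen for z is x, nothing flips. If it is τ x, the ambient sign and the normal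
  -- sign both flip and cancel.
  rcases hτ.eq_or_eq x (m z) ((hm z).trans hxz.symm) with h | h
  · have h5 := hsign z
    have h6 := hside z
    rw [h] at h5 h6
    rw [orientationSign_inducedChart (he s) (he z) s z hzs (hse z) (hpush ?_), ← hxz, ← h4, h5]
    filter_upwards [hx3, h6] with y hy hy'
    exact fun hpos => hy'.1.1 (hy.1.2 hpos)
  · have h5 := hsign z
    have h6 := hside z
    rw [h] at h5 h6
    rw [orientationSign_inducedChart_neg (he s) (he z) s z hzs (hse z) (hpush ?_), ← hxz, ← h4,
      hτ.orientationSign_swap hp hc (he z).chart hxz', hrev, h5]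
    · rfl
    filter_upwards [hx3, hcτ.continuousAt.eventually h6] with y hy hy'
    rw [hτ.map_eq, hτ.involutive] at hy'
    exact fun hpos => hy'.2.1 (hy.1.2 hpos)

end IsHalf

end FromHalf

/-! ### A half from an orientation of the complement; connectedness of the preimage of S. -/

section ToHalf

variable {n : ℕ} {M N : Type*} [MetricSpace M] [MetricSpace N] {p : M → N} {τ : M → M}
  {S : Set N} {D : Set M}

local notation "𝔼" n => EuclideanSpace ℝ (Fin n)

theorem relativeSign_comp {X Y Z : Type*} [MetricSpace X] [MetricSpace Y] [MetricSpace Z]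
    {f : X → Y} {g : Y → Z} (hf : IsLocalIsometry f) (hg : IsLocalIsometry g)
    {c : X → OpenPartialHomeomorph X (𝔼 n)} {c' : Y → OpenPartialHomeomorph Y (𝔼 n)}
    {c'' : Z → OpenPartialHomeomorph Z (𝔼 n)} (hc : IsOrientedChoice c)
    (hc' : IsOrientedChoice c') (hc'' : IsOrientedChoice c'') (x : X) :
    relativeSign (g ∘ f) c c'' x = relativeSign f c c' x * relativeSign g c' c'' (f x) :=
  orientationSign_comp hf hg (hc.chart x) (hc'.chart _) (hc''.chart _) (hc.mem_source x)
    (hc'.mem_source _) (hc''.mem_source _)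

/-- If the complement of `S` is orientable, then the points at which the covering preserves the
orientation form a half of the complement of the preimage of `S`. -/
theorem IsSheetSwap.exists_isHalf_of_isOrientable (hτ : IsSheetSwap p τ) (hp : IsLocalIsometry p)
    (hS : IsClosed S) (hor : IsOrientable n (Sᶜ : Set N))
    {c : M → OpenPartialHomeomorph M (𝔼 n)} (hc : IsOrientedChoice c)
    (hrev : ∀ x, relativeSign τ c c x = -1) : ∃ D, IsHalf p τ S D := by
  obtain ⟨c', hc'⟩ := hor.exists_choice
  have hf : IsLocalIsometry (Sᶜ.restrictPreimage p) := hp.restrictPreimage Sᶜ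
  have hWo : IsOpen (p ⁻¹' Sᶜ) := hS.isOpen_compl.preimage hp.continuous
  obtain ⟨c₁, hc₁⟩ := (hor.of_isLocalIsometry hf).exists_choice
  set j : (p ⁻¹' Sᶜ : Set M) → M := Subtype.val
  have hj : IsLocalIsometry j := IsLocalIsometry.subtype_val hWo
  let t : (p ⁻¹' Sᶜ : Set M) → (p ⁻¹' Sᶜ : Set M) :=
    fun x => ⟨τ x, by rw [Set.mem_preimage, hτ.map_eq]; exact x.2⟩
  have hτl := hτ.isLocalIsometry hp
  have ht : IsLocalIsometry t := hj.of_comp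
    (Continuous.subtype_mk (hτl.continuous.comp continuous_subtype_val) _) (hτl.comp hj)
  -- This is the sign of p relative to c and c'. It is routed through the auxiliary orientation c₁,
  -- since p maps to the complement of S only on a subset of M.
  let δ : (p ⁻¹' Sᶜ : Set M) → SignType := fun x =>
    relativeSign j c₁ c x * relativeSign (Sᶜ.restrictPreimage p) c₁ c' x
  have hδ0 : ∀ x, δ x ≠ 0 := fun x =>
    mul_ne_zero (relativeSign_ne_zero hc₁ hc hj x) (relativeSign_ne_zero hc₁ hc' hf x)
  have hδloc : ∀ x, ∀ᶠ y in 𝓝 x, δ y = δ x := fun x => by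
    filter_upwards [eventually_relativeSign_eq hc₁ hc hj x,
      eventually_relativeSign_eq hc₁ hc' hf x] with y h1 h2
    simp only [δ, h1, h2]
  -- The covering satisfies p ∘ t = p, whereas the inclusion turns t into τ, which reverses
  -- orientation.
  have hδτ : ∀ x, δ (t x) = -δ x := by
    intro x
    have h1 := relativeSign_comp ht hj hc₁ hc₁ hc x
    have h2 := relativeSign_comp hj hτl hc₁ hc hc x
    have h3 := relativeSign_comp ht hf hc₁ hc₁ hc' x
    have e1 : j ∘ t = τ ∘ j := rfl
    have e2 : Sᶜ.restrictPreimage p ∘ t = Sᶜ.restrictPreimage p :=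
      funext fun y => Subtype.ext (hτ.map_eq y)
    rw [e1, h2, hrev] at h1
    rw [e2] at h3
    have h4 := relativeSign_ne_zero hc₁ hc₁ ht x
    simp only [δ, h3]
    generalize relativeSign t c₁ c₁ x = a at *
    generalize relativeSign j c₁ c (t x) = b at *
    generalize relativeSign j c₁ c x = d at *
    generalize relativeSign (Sᶜ.restrictPreimage p) c₁ c' (t x) = f at *
    clear * - h1 h4
    revert a b d f
    decide
  refine ⟨j '' {x | δ x = 1}, hj.isOpenMap _ ?_, ?_, ?_, ?_⟩
  · rw [isOpen_iff_mem_nhds]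
    intro x hx
    filter_upwards [hδloc x] with y hy
    exact hy.trans hx
  · rintro _ ⟨x, -, rfl⟩
    exact x.2
  · intro x hx
    have h0 := hδ0 ⟨x, hx⟩
    rcases h : δ ⟨x, hx⟩ with _ | _ | _
    · exact absurd h h0
    · refine Or.inr ⟨t ⟨x, hx⟩, ?_, rfl⟩
      rw [Set.mem_ofPred_eq, hδτ, h]
      rfl
    · exact Or.inl ⟨⟨x, hx⟩, h, rfl⟩
  · rintro _ ⟨x, hx, rfl⟩ ⟨y, hy, hyx⟩
    have : y = t x := Subtype.ext hyx
    rw [Set.mem_ofPred_eq, this, hδτ, hx] at hy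
    exact absurd hy (by decide)

/-- If `S` is one-sided, then its preimage is connected. -/
theorem IsHalf.isPreconnected_preimage [PreconnectedSpace M] (hD : IsHalf p τ S D)
    (hτ : IsSheetSwap p τ) (hp : IsLocalIsometry p) (hsurj : Function.Surjective p)
    (hSclosed : IsClosed S) (hS : IsTotallyGeodesicHypersurface n S) (hSc : IsPreconnected S)
    (hone : IsOneSided S) : IsPreconnected (p ⁻¹' S) := by
  by_contra hnot
  obtain ⟨u, v, hu, hv, hcov, hno, hiff⟩ := hτ.exists_separation hp hsurj hSc hnot
  have hτS : ∀ x, p x ∈ S → p (τ x) ∈ S := fun x hx => by rwa [hτ.map_eq]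
  have hpre : IsClosed (p ⁻¹' S) := hSclosed.preimage hp.continuous
  have hcτ := (hτ.isLocalIsometry hp).continuous
  -- The two sheets of Σ are disjoint closed sets, so the metric space M separates them by open
  -- sets. Then P ∩ τ⁻¹ Q is a neighbourhood of the first sheet that misses its own image under τ,
  -- and p is injective on it.
  obtain ⟨P, Q, hP, hQ, hCP, hCQ, hPQ⟩ := normal_separation (hpre.inter hv.isClosed_compl)
    (hpre.inter hu.isClosed_compl) (Set.disjoint_left.2 fun x hx hx' =>
      (hcov hx.1).elim (fun h => hx'.2 h) fun h => hx.2 h)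
  have hC : ∀ x, p x ∈ S → x ∈ u → x ∈ P ∩ τ ⁻¹' Q := fun x hx hxu =>
    ⟨hCP ⟨hx, hno x hx hxu⟩, hCQ ⟨hτS x hx, fun h =>
      hno _ (hτS x hx) h ((hiff x hx).1 hxu)⟩⟩
  have hO : IsOpen (P ∩ τ ⁻¹' Q) := hP.inter (hQ.preimage hcτ)
  have hOτ : ∀ x ∈ P ∩ τ ⁻¹' Q, τ x ∉ P ∩ τ ⁻¹' Q := fun x hx hx' =>
    Set.disjoint_left.1 hPQ hx'.1 hx.2
  have hsec : ∀ s ∈ S, ∃ x, p x = s ∧ x ∈ u := by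
    intro s hs
    obtain ⟨x, rfl⟩ := hsurj s
    rcases hcov hs with h | h
    · exact ⟨x, rfl, h⟩
    · refine ⟨τ x, hτ.map_eq x, ?_⟩
      rw [hiff _ (hτS x hs), hτ.involutive]
      exact h
  have hcl : ∀ {A : Set M}, (∀ x, p x ∈ S → x ∈ closure A) →
      S ⊆ closure (p '' ((P ∩ τ ⁻¹' Q) ∩ A)) := by
    intro A hA s hs
    obtain ⟨x, rfl, hxu⟩ := hsec s hs
    have h1 : x ∈ closure ((P ∩ τ ⁻¹' Q) ∩ A) :=
      hO.inter_closure ⟨hC x hs hxu, hA x hs⟩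
    exact map_mem_closure hp.continuous h1 fun y hy => Set.mem_image_of_mem p hy
  refine hone ⟨p '' ((P ∩ τ ⁻¹' Q) ∩ D), p '' ((P ∩ τ ⁻¹' Q) ∩ τ ⁻¹' D),
    hp.isOpenMap _ (hO.inter hD.isOpen), hp.isOpenMap _ (hO.inter (hD.isOpen_swap hτ hp)),
    ?_, ?_, ?_, ?_, hcl fun x hx => (hD.mem_closure hτ hp hsurj hS hSc hx).1,
    hcl fun x hx => (hD.mem_closure hτ hp hsurj hS hSc hx).2⟩
  · rw [Set.disjoint_left]
    rintro _ ⟨x, hx, rfl⟩ ⟨y, hy, hyx⟩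
    rcases hτ.eq_or_eq x y hyx with rfl | rfl
    · exact hD.swap_notMem _ hx.2 hy.2
    · exact hOτ x hx.1 hy.1
  · rw [Set.disjoint_left]
    rintro _ ⟨x, hx, rfl⟩ hS
    exact hD.notMem x hx.2 hS
  · rw [Set.disjoint_left]
    rintro _ ⟨x, hx, rfl⟩ hS
    exact hD.notMem _ hx.2 (hτS x hS)
  · have : p '' ((P ∩ τ ⁻¹' Q) ∩ D) ∪ S ∪ p '' ((P ∩ τ ⁻¹' Q) ∩ τ ⁻¹' D) =
        p '' (P ∩ τ ⁻¹' Q) := by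
      ext s
      constructor
      · rintro ((⟨x, hx, rfl⟩ | hs) | ⟨x, hx, rfl⟩)
        · exact ⟨x, hx.1, rfl⟩
        · obtain ⟨x, rfl, hxu⟩ := hsec s hs
          exact ⟨x, hC x hs hxu, rfl⟩
        · exact ⟨x, hx.1, rfl⟩
      · rintro ⟨x, hx, rfl⟩
        by_cases hxS : p x ∈ S
        · exact Or.inl (Or.inr hxS)
        · rcases hD.mem_or x hxS with h | h
          · exact Or.inl (Or.inl ⟨x, ⟨hx, h⟩, rfl⟩)
          · exact Or.inr ⟨x, ⟨hx, h⟩, rfl⟩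
    rw [this]
    exact hp.isOpenMap _ hO

end ToHalf

/-! ### Cross-sections and their reflections. -/

section CrossSection

variable {N : Type*} [MetricSpace N] {ρ : N ≃ᵢ N} {S : Set N}

theorem IsCrossSection.fixed (hS : IsCrossSection ρ S) {s : N} (hs : s ∈ S) : ρ s = s := by
  obtain ⟨x, -, rfl⟩ := hS.component
  exact connectedComponentIn_subset (Function.fixedPoints ρ) x hs

theorem IsCrossSection.isConnected (hS : IsCrossSection ρ S) : IsConnected S := by
  obtain ⟨x, hx, rfl⟩ := hS.component
  exact isConnected_connectedComponentIn_iff.2 hx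

theorem IsCrossSection.isClosed (hS : IsCrossSection ρ S) : IsClosed S := by
  obtain ⟨x, hx, rfl⟩ := hS.component
  have hF : IsClosed (Function.fixedPoints ρ) := isClosed_eq ρ.continuous continuous_id
  refine isClosed_of_closure_subset (IsPreconnected.subset_connectedComponentIn
    isPreconnected_connectedComponentIn.closure (subset_closure (mem_connectedComponentIn hx)) ?_)
  exact closure_minimal (connectedComponentIn_subset _ _) hF

/-- The involution of a cross-section is the reflection in it. -/
theorem IsCrossSection.exists_reflection (hS : IsCrossSection ρ S) {s : N} (hs : s ∈ S) :
    ∃ e, IsAdaptedChart 3 S e ∧ s ∈ e.source ∧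
      ∀ᶠ y in 𝓝 s, e (ρ y) = coordReflection (Fin.last 3) (e y) := by
  obtain ⟨e, he, hse⟩ := hS.hypersurface.exists_chart hs
  refine ⟨e, he, hse, (he.eq_or_eq_reflection hse hs ρ.isLocalIsometry
    fun y hy => hS.fixed hy).resolve_left fun h => ?_⟩
  have h1 : Tendsto e.symm (𝓝 (e s)) (𝓝 s) := by
    have := e.continuousAt_symm (e.map_source hse)
    rwa [ContinuousAt, e.left_inv hse] at this
  obtain ⟨ε, hε, hball⟩ := Metric.mem_nhds_iff.1
    (inter_mem (e.open_target.mem_nhds (e.map_source hse)) (h1.eventually h))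
  -- If ρ were the identity near s, a connected open set around s would consist of fixed points and
  -- so lie in the component S, which contains no open set.
  have hsub : e.symm '' Metric.ball (e s) ε ⊆ S := by
    obtain ⟨x, hx, hSx⟩ := hS.component
    rw [hSx] at hs
    rw [hSx, connectedComponentIn_eq hs]
    refine IsPreconnected.subset_connectedComponentIn
      ((convex_ball _ _).isPreconnected.image _ (e.continuousOn_symm.mono
        fun v hv => (hball hv).1)) ⟨e s, Metric.mem_ball_self hε, e.left_inv hse⟩ ?_
    rintro _ ⟨v, hv, rfl⟩
    exact (hball hv).2
  obtain ⟨y, hy, hye, hyb⟩ := ((he.frequently_positive hse hs).and_eventually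
    (inter_mem (e.open_source.mem_nhds hse)
      ((e.continuousAt hse).preimage_mem_nhds (Metric.ball_mem_nhds _ hε)))).exists
  exact hy.ne' ((he.mem_iff y hye).1 (hsub ⟨e y, hyb, e.left_inv hye⟩))

end CrossSection

/-! ### The lifted reflection of M. -/

section Reflection

variable {M N : Type*} [MetricSpace M] [MetricSpace N] {p : M → N} {τ : M → M}
  {S : Set N} {D : Set M} {ρ : N ≃ᵢ N}

/-- The lift of the involution of a cross-section that interchanges the two halves is a local
isometry. -/
theorem IsHalf.isLocalIsometry_lift [PreconnectedSpace M] (hD : IsHalf p τ S D)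
    (hτ : IsSheetSwap p τ) (hp : IsLocalIsometry p) (hsurj : Function.Surjective p)
    (hS : IsCrossSection ρ S) {θ : M → M} (hθ : ∀ x, p (θ x) = ρ (p x))
    (hθS : ∀ x, p x ∈ S → θ x = x) (hθD : ∀ x, p x ∉ S → (θ x ∈ D ↔ x ∉ D)) :
    IsLocalIsometry θ := by
  have hρS : ∀ y, ρ y ∈ S → y ∈ S := fun y hy => by
    rw [← hS.involutive y, hS.fixed hy]
    exact hy
  have hθmem : ∀ x, p (θ x) ∈ S → p x ∈ S := fun x hx => hρS _ (hθ x ▸ hx)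
  have hcτ := (hτ.isLocalIsometry hp).continuous
  refine hp.of_comp ?_ (by
    have : p ∘ θ = ρ ∘ p := funext hθ
    rw [this]
    exact ρ.isLocalIsometry.comp hp)
  -- As p is open, continuity of θ follows once points near θ x that lie over ρ (p y) are known to
  -- be θ y and not its partner under τ.
  have key : ∀ x, ∃ W ∈ 𝓝 (θ x), ∀ᶠ y in 𝓝 x, ∀ w ∈ W, p w = ρ (p y) → w = θ y := by
    intro x
    have hor : ∀ y w, p w = ρ (p y) → w = θ y ∨ τ w = θ y := fun y w hw =>
      (hτ.eq_or_eq (θ y) w (hw.trans (hθ y).symm)).imp_right fun h => by rw [h, hτ.involutive]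
    by_cases hx : p x ∈ S
    · obtain ⟨e, he, hxe, hρ⟩ := hS.exists_reflection hx
      obtain ⟨e₁, he₁, hxe₁, -, heq⟩ := he.exists_pullback hp hxe
      have hcl := hD.mem_closure hτ hp hsurj hS.hypersurface hS.isConnected.isPreconnected hx
      -- Since ρ negates the last coordinate, such a point near Σ lies on the side opposite to y,
      -- which is also the half that contains θ y.
      have hneg : ∀ᶠ y in 𝓝 x, ∀ w, p w = ρ (p y) → e₁ w (Fin.last 3) = -e₁ y (Fin.last 3) := by
        filter_upwards [hp.continuous.continuousAt.eventually hρ] with y hy w hw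
        rw [heq, heq, hw, hy, coordReflection_apply_self]
      have hinj : ∀ y ∈ e₁.source, ∀ w ∈ e₁.source, p w = p y → w = y := fun y hy w hw h =>
        e₁.injOn hw hy (by rw [heq, heq, h])
      rw [hθS x hx]
      have hsrc := e₁.open_source.mem_nhds hxe₁
      rcases hD.eventually_sides hτ hp he₁ hxe₁ hcl.1 hcl.2 with h | h
      all_goals
        refine ⟨_, inter_mem h hsrc, ?_⟩
        filter_upwards [h, hsrc, hneg] with y hy hys hyneg w hw hpw
        by_cases hyS : p y ∈ S
        · rw [hθS y hyS]
          exact hinj y hys w hw.2 (hpw.trans (hS.fixed hyS))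
        · refine (hor y w hpw).resolve_right fun h1 => ?_
          have h2 := hθD y hyS
          have h3 := hw.1
          simp only [Set.mem_ofPred_eq, hyneg w hpw, Left.neg_pos_iff, Left.neg_neg_iff, h1] at h3
          tauto
    · rcases hD.mem_or x hx with h | h
      · have hθx : θ x ∈ τ ⁻¹' D := (hD.mem_or (θ x) fun h' => hx (hθmem x h')).resolve_left
          fun h' => (hθD x hx).1 h' h
        refine ⟨_, (hD.isOpen_swap hτ hp).mem_nhds hθx, ?_⟩
        filter_upwards [hD.isOpen.mem_nhds h] with y hy w hw hpw
        refine (hor y w hpw).resolve_right fun h1 => ?_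
        have hw' : θ y ∈ D := h1 ▸ hw
        exact (hθD y (hD.notMem y hy)).1 hw' hy
      · have hxD : x ∉ D := fun h' => hD.swap_notMem x h' h
        refine ⟨_, hD.isOpen.mem_nhds ((hθD x hx).2 hxD), ?_⟩
        filter_upwards [(hD.isOpen_swap hτ hp).mem_nhds h] with y hy w hw hpw
        refine (hor y w hpw).resolve_right fun h1 => ?_
        have hyD : y ∉ D := fun h' => hD.swap_notMem y h' hy
        have hyS : p y ∉ S := hτ.map_eq y ▸ hD.notMem _ hy
        exact hD.swap_notMem w hw (h1 ▸ (hθD y hyS).2 hyD)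
  rw [continuous_iff_continuousAt]
  intro x W hW
  obtain ⟨W', hW', hev⟩ := key x
  have h1 : p '' (W ∩ W') ∈ 𝓝 (ρ (p x)) := by
    rw [← hθ]
    exact hp.isOpenMap.image_mem_nhds (inter_mem hW hW')
  rw [mem_map]
  filter_upwards [hev, (ρ.continuous.comp hp.continuous).continuousAt.preimage_mem_nhds h1]
    with y hy hy'
  obtain ⟨w, hw, hwy⟩ := hy'
  rw [Set.mem_preimage, ← hy w hw.2 hwy]
  exact hw.1

/-- The involution of a cross-section has a lift that interchanges the two halves. -/
theorem IsHalf.exists_lift (hD : IsHalf p τ S D) (hτ : IsSheetSwap p τ)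
    (hsurj : Function.Surjective p) (hS : IsCrossSection ρ S) :
    ∃ θ : M → M, (∀ x, p (θ x) = ρ (p x)) ∧ (∀ x, p x ∈ S → θ x = x) ∧
      ∀ x, p x ∉ S → (θ x ∈ D ↔ x ∉ D) := by
  have hρS : ∀ y, ρ y ∈ S → y ∈ S := fun y hy => by
    rw [← hS.involutive y, hS.fixed hy]
    exact hy
  have hex : ∀ x, ∃ z, p z = ρ (p x) ∧ (p x ∈ S → z = x) ∧ (p x ∉ S → (z ∈ D ↔ x ∉ D)) := by
    intro x
    by_cases hx : p x ∈ S
    · exact ⟨x, (hS.fixed hx).symm, fun _ => rfl, fun h => absurd hx h⟩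
    · obtain ⟨z, hz⟩ := hsurj (ρ (p x))
      have hzS : p z ∉ S := fun h => hx (hρS _ (hz ▸ h))
      -- Exactly one of z and τ z lies in the half prescribed by x.
      by_cases h : z ∈ D ↔ x ∉ D
      · exact ⟨z, hz, fun h => absurd h hx, fun _ => h⟩
      · refine ⟨τ z, (hτ.map_eq z).trans hz, fun h => absurd h hx, fun _ => ?_⟩
        have h1 := hD.mem_or z hzS
        have h2 := hD.swap_notMem z
        tauto
  choose θ h1 h2 h3 using hex
  exact ⟨θ, h1, h2, h3⟩

/-- Away from Σ the point θ (θ x) lies over p x and in the same half as x, which excludes τ x. -/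
theorem IsHalf.lift_involutive (hD : IsHalf p τ S D) (hτ : IsSheetSwap p τ)
    (hS : IsCrossSection ρ S) {θ : M → M} (hθ : ∀ x, p (θ x) = ρ (p x))
    (hθS : ∀ x, p x ∈ S → θ x = x) (hθD : ∀ x, p x ∉ S → (θ x ∈ D ↔ x ∉ D)) :
    Function.Involutive θ := by
  intro x
  by_cases hx : p x ∈ S
  · rw [hθS x hx, hθS x hx]
  · have hx' : p (θ x) ∉ S := by
      rw [hθ]
      intro h
      apply hx
      rw [← hS.involutive (p x), hS.fixed h]
      exact h
    have h1 := hθD x hx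
    have h2 := hθD _ hx'
    refine (hτ.eq_or_eq x (θ (θ x)) (by rw [hθ, hθ, hS.involutive])).resolve_right fun h => ?_
    rw [h] at h2
    have h3 := hD.mem_or x hx
    have h4 := hD.swap_notMem x
    tauto

/-- The lift is orientation reversing. -/
theorem IsCrossSection.relativeSign_lift [PreconnectedSpace M] (hS : IsCrossSection ρ S)
    (hp : IsLocalIsometry p) (hsurj : Function.Surjective p) {θ : M → M}
    (hθ : ∀ x, p (θ x) = ρ (p x)) (hθS : ∀ x, p x ∈ S → θ x = x) (hθl : IsLocalIsometry θ)
    {c : M → OpenPartialHomeomorph M (EuclideanSpace ℝ (Fin 4))} (hc : IsOrientedChoice c)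
    (x : M) : relativeSign θ c c x = -1 := by
  obtain ⟨s, hs⟩ := hS.isConnected.nonempty
  obtain ⟨m, rfl⟩ := hsurj s
  -- The sign is constant, so it is computed at a point over S, where θ fixes m and is a reflection
  -- in the chart.
  rw [relativeSign_const hc hc hθl x m]
  obtain ⟨e, he, hme, hρ⟩ := hS.exists_reflection hs
  obtain ⟨e₁, he₁, hme₁, -, heq⟩ := he.exists_pullback hp hme
  have hθm := hθS m hs
  have hθe : θ m ∈ e₁.source := hθm.symm ▸ hme₁
  have h1 : orientationSign θ e₁ e₁ m = -1 := by
    have h2 : (fun v => e₁ (θ (e₁.symm v))) =ᶠ[𝓝 (e₁ m)]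
        fun v => reflectChart (Fin.last 3) e₁ (e₁.symm v) := by
      have h3 : Tendsto e₁.symm (𝓝 (e₁ m)) (𝓝 m) := by
        have := e₁.continuousAt_symm (e₁.map_source hme₁)
        rwa [ContinuousAt, e₁.left_inv hme₁] at this
      filter_upwards [h3.eventually (hp.continuous.continuousAt.eventually hρ)] with v hv
      rw [heq, hθ, hv, reflectChart_apply, heq]
    have h3 := orientationSign_reflectChart (f := fun y : M => y) (e := e₁) (e' := e₁) (x := m)
      (Fin.last 3)
    rw [orientationSign_self he₁.chart hme₁] at h3
    rw [← h3, orientationSign, h2.fderiv_eq]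
    rfl
  have h2 := orientationSign_comp IsLocalIsometry.id hθl (hc.chart m) he₁.chart he₁.chart
    (hc.mem_source m) hme₁ hθe
  have h3 := orientationSign_comp hθl IsLocalIsometry.id (hc.chart m) he₁.chart (hc.chart (θ m))
    (hc.mem_source m) hθe (hc.mem_source _)
  -- As θ m = m, the change between e₁ and `c m` enters twice and its sign cancels.
  have h4 : orientationSign (fun y => y) e₁ (c (θ m)) (θ m) =
      orientationSign (fun y => y) (c m) e₁ m := by
    rw [hθm, orientationSign_symm (hc.chart m) he₁.chart (hc.mem_source m) hme₁]
  have h5 := orientationSign_ne_zero IsLocalIsometry.id (hc.chart m) he₁.chart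
    (hc.mem_source m) hme₁
  rw [h2, h1, h4] at h3
  rw [relativeSign, h3]
  generalize orientationSign (fun y => y) (c m) e₁ m = a at h5
  revert a
  decide

theorem isOrientationReversing_of_relativeSign {n : ℕ} {θ : M ≃ᵢ M} {A} (hA : IsOrientedAtlas n A)
    {c : M → OpenPartialHomeomorph M (EuclideanSpace ℝ (Fin n))} (hc : IsOrientedChoice c)
    (hcA : ∀ x, c x ∈ A) (h : ∀ x, relativeSign θ c c x = -1) : IsOrientationReversing n θ := by
  refine ⟨A, hA, fun e he e' he' x hx hx' => ?_⟩
  have hec := hA.isHyperbolicChart e he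
  have hec' := hA.isHyperbolicChart e' he'
  have h1 : orientationSign (fun y => y) e (c x) x = 1 :=
    sign_eq_one_iff.2 (hA.det_pos e he _ (hcA x) x hx (hc.mem_source x))
  have h2 : orientationSign (fun y => y) (c (θ x)) e' (θ x) = 1 :=
    sign_eq_one_iff.2 (hA.det_pos _ (hcA _) e' he' _ (hc.mem_source _) hx')
  have h3 := orientationSign_comp IsLocalIsometry.id θ.isLocalIsometry hec (hc.chart x)
    (hc.chart (θ x)) hx (hc.mem_source x) (hc.mem_source _)
  have h4 := orientationSign_comp θ.isLocalIsometry IsLocalIsometry.id hec (hc.chart (θ x)) hec'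
    hx (hc.mem_source _) hx'
  have h5 := h x
  rw [relativeSign] at h5
  rw [h3, h1, h2, h5] at h4
  exact sign_eq_neg_one_iff.1 h4

end Reflection

/-! ### The equivalence. -/

theorem mainTheorem3 {N M : Type*} [MetricSpace N] [MetricSpace M]
    (hN : IsHyperbolicManifold 4 N) (hvol : HasFiniteVolume 4 N) (hno : ¬ IsOrientable 4 N)
    (ρ : N ≃ᵢ N) (S : Set N) (hS : IsCrossSection ρ S) (hsep : IsConnected Sᶜ)
    (p : M → N) (hp : IsOrientableDoubleCover p) :
    (IsGravitationalInstanton M (p ⁻¹' S) ∧ IsConnected (p ⁻¹' S)) ↔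
      (IsOrientable 3 S ∧ IsOneSided S ∧ IsOrientable 4 (Sᶜ : Set N)) := by
  have hpl := hp.isLocalIsometry
  have hsurj := surjective_of_two_sheeted hp.two_sheeted
  obtain ⟨τ, hτ⟩ := exists_isSheetSwap hp.two_sheeted
  have : ConnectedSpace M := hp.hyperbolic.connected
  obtain ⟨A, hA⟩ := hp.orientable
  obtain ⟨c, hc, hcA⟩ := hA.exists_choice
  have hrev := hτ.relativeSign_eq_neg_one hpl hsurj (0 : Fin 4) hN hno hc
  have hSc := hS.isConnected
  constructor
  · rintro ⟨hM, hconn⟩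
    obtain ⟨D, hD⟩ := hτ.exists_isHalf hpl hsurj hS.isClosed hsep.isPreconnected hM.separating
    exact ⟨hD.isOrientable_hypersurface hτ hpl hsurj hS.hypersurface hSc.isPreconnected hc hrev,
      hD.isOneSided hτ hpl hsurj hS.hypersurface hSc.isPreconnected hSc.nonempty
        hconn.isPreconnected,
      hD.isOrientable_compl hτ hpl hsurj hS.isClosed hp.orientable⟩
  · rintro ⟨horS, hone, hor⟩
    obtain ⟨D, hD⟩ := hτ.exists_isHalf_of_isOrientable hpl hS.isClosed hor hc hrev
    obtain ⟨θ, hθ, hθS, hθD⟩ := hD.exists_lift hτ hsurj hS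
    have hθl := hD.isLocalIsometry_lift hτ hpl hsurj hS hθ hθS hθD
    obtain ⟨Θ, rfl⟩ := hθl.exists_isometryEquiv hp.hyperbolic
      (hD.lift_involutive hτ hS hθ hθS hθD)
    refine ⟨⟨hp.hyperbolic, hτ.hasFiniteVolume hpl hsurj hvol, hp.orientable,
      hS.hypersurface.preimage hpl, horS.of_isLocalIsometry (hpl.restrictPreimage S), ?_,
      ⟨Θ, hD.lift_involutive hτ hS hθ hθS hθD, ?_, ?_⟩⟩, ?_, ?_⟩
    · intro hpre
      obtain ⟨y, hy⟩ := hsep.nonempty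
      obtain ⟨x, rfl⟩ := hsurj y
      -- The complement of S is nonempty, and the two lifts of one of its points lie in different
      -- halves.
      have hne : ((p ⁻¹' S)ᶜ ∩ D).Nonempty ∧ ((p ⁻¹' S)ᶜ ∩ τ ⁻¹' D).Nonempty := by
        have hy' : p (τ x) ∉ S := by rwa [hτ.map_eq]
        rcases hD.mem_or x hy with h | h
        · exact ⟨⟨x, hy, h⟩, ⟨τ x, hy', by rwa [Set.mem_preimage, hτ.involutive]⟩⟩
        · exact ⟨⟨τ x, hy', h⟩, ⟨x, hy, h⟩⟩
      obtain ⟨z, -, hz1, hz2⟩ := hpre _ _ hD.isOpen (hD.isOpen_swap hτ hpl)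
        (fun z hz => hD.mem_or z hz) hne.1 hne.2
      exact hD.swap_notMem z hz1 hz2
    · exact isOrientationReversing_of_relativeSign hA hc hcA
        (hS.relativeSign_lift hpl hsurj hθ hθS hθl hc)
    · ext x
      refine ⟨fun hx => ?_, fun hx => hθS x hx⟩
      by_contra hxS
      have h1 := hθD x hxS
      rw [show Θ x = x from hx] at h1
      tauto
    · obtain ⟨s, hs⟩ := hSc.nonempty
      obtain ⟨x, rfl⟩ := hsurj s
      exact ⟨x, hs⟩
    · exact hD.isPreconnected_preimage hτ hpl hsurj hS.isClosed hS.hypersurface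
        hSc.isPreconnected hone
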